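/- Let $M$ be a connected, simply connected smooth manifold (finite-dimensional, Hausdorff, second countable, without boundary), and let $\tau$ be a nowhere vanishing smooth one-form on $M$. Put $D = \ker\tau \subseteq TM$ and assume that the restriction of $d\tau$ to $\bigwedge^2 D$ is nonzero at every point of $M$. Let $Z$ be a smooth vector field on $M$ and let $\chi$ be a smooth section of $\bigwedge^2 D$ such that $$\tau(Z) = 1, \qquad d\tau(\chi) = -1,$$ where a two-form $\eta$ is evaluated on two-vectors by $\eta(X\wedge Y) = \eta(X,Y)$ and $d$ is normalized by $d\alpha(X,Y) = X(\alpha(Y)) - Y(\alpha(X)) - \alpha([X,Y])$. For a two-form $\eta$ let $\iota_{\tau\otimes\chi}\eta$ be the one-form $v \mapsto \tau(v)\,\eta(\chi)$, and define the operator $$d_{\tau\otimes\chi} = d\,(\mathrm{id} + \iota_{\tau\otimes\chi}\, d)$$ from one-forms to two-forms. Then there exists a smooth Riemannian metric $g$ on $M$ such that 1. the foliation of $M$ tangent to $Z$ is totally geodesic, that is, every geodesic of a leaf with its induced metric is a geodesic of $(M,g)$, and 2. $D$ is $g$-orthogonal to the line bundle $V = \mathrm{span}\{Z\}$, if and only if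 $$d_{\tau\otimes\chi}\,\mathcal{L}_Z\tau = 0,$$ where $\mathcal{L}_Z\tau$ is the Lie derivative of $\tau$ along $Z$. -/

import Mathlib

open scoped Manifold ContDiff Topology Bundle

noncomputable section

namespace ZFoliation

/-!
Conventions. `M` is a smooth manifold modelled on a finite-dimensional real normed space `E`
(so without boundary). A one-form is a family of continuous linear functionals on the tangent
spaces, a vector field is a family of tangent vectors; smoothness is stated separately.
-/

variable {E : Type*} [NormedAddCommGroup E] [NormedSpace ℝ E]
  {M : Type*} [TopologicalSpace M] [ChartedSpace E M]

/-- Smooth one-forms: smooth sections of the cotangent bundle. -/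
def IsSmoothOneForm [IsManifold 𝓘(ℝ, E) ∞ M]
    (α : Π x : M, TangentSpace 𝓘(ℝ, E) x →L[ℝ] ℝ) : Prop :=
  ContMDiff 𝓘(ℝ, E) (𝓘(ℝ, E).prod 𝓘(ℝ, E →L[ℝ] ℝ)) ∞
    (fun x ↦ Bundle.TotalSpace.mk' (E →L[ℝ] ℝ)
      (E := fun x : M ↦ TangentSpace 𝓘(ℝ, E) x →L[ℝ] ℝ) x (α x))

/-- Vector fields that are smooth on a set: smooth sections of the tangent bundle. -/
def IsSmoothVectorFieldOn [IsManifold 𝓘(ℝ, E) ∞ M]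
    (X : Π x : M, TangentSpace 𝓘(ℝ, E) x) (U : Set M) : Prop :=
  ContMDiffOn 𝓘(ℝ, E) 𝓘(ℝ, E).tangent ∞
    (fun x ↦ (Bundle.TotalSpace.mk' E x (X x) : TangentBundle 𝓘(ℝ, E) M)) U

/-- Smooth vector fields on all of `M`. -/
def IsSmoothVectorField [IsManifold 𝓘(ℝ, E) ∞ M]
    (X : Π x : M, TangentSpace 𝓘(ℝ, E) x) : Prop :=
  IsSmoothVectorFieldOn X Set.univ

/-- Smooth sections of `⋀² D`, for a subbundle `D` of the tangent bundle: two-vector fields which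
are locally finite sums of products `X ∧ Y` of smooth vector fields with values in `D`. -/
def IsSmoothBivectorField [IsManifold 𝓘(ℝ, E) ∞ M]
    (D : Π x : M, Submodule ℝ (TangentSpace 𝓘(ℝ, E) x))
    (χ : Π x : M, ⋀[ℝ]^2 (TangentSpace 𝓘(ℝ, E) x)) : Prop :=
  ∀ x₀ : M, ∃ U : Set M, IsOpen U ∧ x₀ ∈ U ∧
    ∃ (k : ℕ) (X Y : Fin k → Π x : M, TangentSpace 𝓘(ℝ, E) x),
      (∀ i, IsSmoothVectorFieldOn (X i) U ∧ IsSmoothVectorFieldOn (Y i) U) ∧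
      (∀ i, ∀ x ∈ U, X i x ∈ D x ∧ Y i x ∈ D x) ∧
      ∀ x ∈ U, χ x = ∑ i, exteriorPower.ιMulti ℝ 2 ![X i x, Y i x]

/-- The one-form `α` in the chart at `x`: its pullback by the inverse of the chart. -/
def oneFormInChart (α : Π x : M, TangentSpace 𝓘(ℝ, E) x →L[ℝ] ℝ) (x : M) (y : E) :
    E →L[ℝ] ℝ :=
  (α ((extChartAt 𝓘(ℝ, E) x).symm y)).comp
    (mfderiv 𝓘(ℝ, E) 𝓘(ℝ, E) (extChartAt 𝓘(ℝ, E) x).symm y)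

/-- The vector field `X` in the chart at `x`. -/
def vectorFieldInChart (X : Π x : M, TangentSpace 𝓘(ℝ, E) x) (x : M) (y : E) : E :=
  VectorField.mpullback 𝓘(ℝ, E) 𝓘(ℝ, E) (extChartAt 𝓘(ℝ, E) x).symm X y

/-- The exterior derivative `dα` of a one-form, computed at `x` in the chart at `x`. The
normalization is `dα(X, Y) = X(α(Y)) - Y(α(X)) - α([X, Y])`. -/
def extD (α : Π x : M, TangentSpace 𝓘(ℝ, E) x →L[ℝ] ℝ) (x : M) :
    (TangentSpace 𝓘(ℝ, E) x) [⋀^Fin 2]→L[ℝ] ℝ :=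
  (extDeriv (fun y : E ↦ ContinuousAlternatingMap.ofSubsingleton ℝ E ℝ (0 : Fin 1)
      (oneFormInChart α x y)) (extChartAt 𝓘(ℝ, E) x x)).compContinuousLinearMap
    (mfderiv 𝓘(ℝ, E) 𝓘(ℝ, E) (extChartAt 𝓘(ℝ, E) x) x)

/-- The Lie derivative `L_Z α` of a one-form, computed at `x` in the chart at `x`: in coordinates,
`(L_Z α)_j = Z^i ∂_i α_j + α_i ∂_j Z^i`. -/
def lieDerivOneForm (Z : Π x : M, TangentSpace 𝓘(ℝ, E) x)
    (α : Π x : M, TangentSpace 𝓘(ℝ, E) x →L[ℝ] ℝ) (x : M) :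
    TangentSpace 𝓘(ℝ, E) x →L[ℝ] ℝ :=
  (fderiv ℝ (oneFormInChart α x) (extChartAt 𝓘(ℝ, E) x x)
        (vectorFieldInChart Z x (extChartAt 𝓘(ℝ, E) x x)) +
      (oneFormInChart α x (extChartAt 𝓘(ℝ, E) x x)).comp
        (fderiv ℝ (vectorFieldInChart Z x) (extChartAt 𝓘(ℝ, E) x x))).comp
    (mfderiv 𝓘(ℝ, E) 𝓘(ℝ, E) (extChartAt 𝓘(ℝ, E) x) x)

/-- The value `η(ξ)` of an alternating two-form `η` on a two-vector `ξ`; it is determined by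
`η(v ∧ w) = η(v, w)`. -/
def evalBivector {F : Type*} [AddCommGroup F] [Module ℝ F] [TopologicalSpace F]
    (η : F [⋀^Fin 2]→L[ℝ] ℝ) (ξ : ⋀[ℝ]^2 F) : ℝ :=
  exteriorPower.alternatingMapLinearEquiv η.toAlternatingMap ξ

/-- The contraction `ι_{τ ⊗ χ}` from two-forms to one-forms:
`(ι_{τ ⊗ χ} η)(v) = η((τ ⊗ χ)(v)) = τ(v) η(χ)`. -/
def contraction (τ : Π x : M, TangentSpace 𝓘(ℝ, E) x →L[ℝ] ℝ)
    (χ : Π x : M, ⋀[ℝ]^2 (TangentSpace 𝓘(ℝ, E) x))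
    (η : Π x : M, (TangentSpace 𝓘(ℝ, E) x) [⋀^Fin 2]→L[ℝ] ℝ) (x : M) :
    TangentSpace 𝓘(ℝ, E) x →L[ℝ] ℝ :=
  evalBivector (η x) (χ x) • τ x

/-- The operator `d_{τ ⊗ χ} = d (id + ι_{τ ⊗ χ} d)` on one-forms. -/
def dSelector (τ : Π x : M, TangentSpace 𝓘(ℝ, E) x →L[ℝ] ℝ)
    (χ : Π x : M, ⋀[ℝ]^2 (TangentSpace 𝓘(ℝ, E) x))
    (β : Π x : M, TangentSpace 𝓘(ℝ, E) x →L[ℝ] ℝ) (x : M) :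
    (TangentSpace 𝓘(ℝ, E) x) [⋀^Fin 2]→L[ℝ] ℝ :=
  extD (fun p ↦ β p + contraction τ χ (extD β) p) x

/-- The kernel of a one-form. -/
def kerForm (τ : Π x : M, TangentSpace 𝓘(ℝ, E) x →L[ℝ] ℝ) (x : M) :
    Submodule ℝ (TangentSpace 𝓘(ℝ, E) x) :=
  LinearMap.ker (τ x).toLinearMap

/-- The pullback `(u, v) ↦ b (A u) (A v)` of a bilinear form `b` by a linear map `A`. -/
def pullbackBilin {F G : Type*} [AddCommGroup F] [Module ℝ F] [TopologicalSpace F]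
    [AddCommGroup G] [Module ℝ G] [TopologicalSpace G] (b : G →L[ℝ] G →L[ℝ] ℝ) (A : F →L[ℝ] G) :
    F →L[ℝ] F →L[ℝ] ℝ :=
  (ContinuousLinearMap.precomp ℝ A).comp (b.comp A)

/-- The metric tensor `g` in the chart at `x`: its pullback by the inverse of the chart. -/
def metricInChart (g : Π x : M, TangentSpace 𝓘(ℝ, E) x →L[ℝ] TangentSpace 𝓘(ℝ, E) x →L[ℝ] ℝ)
    (x : M) (y : E) : E →L[ℝ] E →L[ℝ] ℝ :=
  pullbackBilin (g ((extChartAt 𝓘(ℝ, E) x).symm y))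
    (mfderiv 𝓘(ℝ, E) 𝓘(ℝ, E) (extChartAt 𝓘(ℝ, E) x).symm y)

/-- The Christoffel symbols of the first kind of (the Levi-Civita connection of) `g` in the chart
at `x`: in that chart, `Γ(u, v; w) = g(∇_u v, w)` for constant vector fields `u`, `v`, `w`. -/
def christoffel (g : Π x : M, TangentSpace 𝓘(ℝ, E) x →L[ℝ] TangentSpace 𝓘(ℝ, E) x →L[ℝ] ℝ)
    (x : M) (y u v w : E) : ℝ :=
  (fderiv ℝ (metricInChart g x) y u v w + fderiv ℝ (metricInChart g x) y v u w
    - fderiv ℝ (metricInChart g x) y w u v) / 2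

/-- The curve `c`, defined on the open interval `J`, is a geodesic of the metric tensor `g`: it is
smooth, and at each time `t` it satisfies the geodesic equation `c'' + Γ(c', c') = 0` in the chart
at `c t`. The equation is written with its index lowered by `g`. -/
def IsGeodesicOn
    (g : Π x : M, TangentSpace 𝓘(ℝ, E) x →L[ℝ] TangentSpace 𝓘(ℝ, E) x →L[ℝ] ℝ)
    (c : ℝ → M) (J : Set ℝ) : Prop :=
  ContMDiffOn 𝓘(ℝ, ℝ) 𝓘(ℝ, E) ∞ c J ∧
    ∀ t ∈ J, ∀ w : E,
      metricInChart g (c t) (extChartAt 𝓘(ℝ, E) (c t) (c t))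
          (deriv (deriv fun s ↦ extChartAt 𝓘(ℝ, E) (c t) (c s)) t) w
        + christoffel g (c t) (extChartAt 𝓘(ℝ, E) (c t) (c t))
            (deriv (fun s ↦ extChartAt 𝓘(ℝ, E) (c t) (c s)) t)
            (deriv (fun s ↦ extChartAt 𝓘(ℝ, E) (c t) (c s)) t) w = 0

/-- The pullback `ι^* g` of a metric tensor by a map `ι : N → M`. If `ι` is the inclusion of an
immersed submanifold, this is the induced metric. -/
def pullbackMetric {F : Type*} [NormedAddCommGroup F] [NormedSpace ℝ F]
    {N : Type*} [TopologicalSpace N] [ChartedSpace F N]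
    (g : Π x : M, TangentSpace 𝓘(ℝ, E) x →L[ℝ] TangentSpace 𝓘(ℝ, E) x →L[ℝ] ℝ)
    (ι : N → M) (p : N) :
    TangentSpace 𝓘(ℝ, F) p →L[ℝ] TangentSpace 𝓘(ℝ, F) p →L[ℝ] ℝ :=
  pullbackBilin (g (ι p)) (mfderiv 𝓘(ℝ, F) 𝓘(ℝ, E) ι p)

/-- An immersed submanifold `ι : N → M` is totally geodesic if the geodesics of `N`, for the
induced metric, are geodesics of `M`. -/
def IsTotallyGeodesic {F : Type*} [NormedAddCommGroup F] [NormedSpace ℝ F]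
    {N : Type*} [TopologicalSpace N] [ChartedSpace F N]
    (g : Π x : M, TangentSpace 𝓘(ℝ, E) x →L[ℝ] TangentSpace 𝓘(ℝ, E) x →L[ℝ] ℝ)
    (ι : N → M) : Prop :=
  ∀ (J : Set ℝ) (c : ℝ → N), IsOpen J → J.OrdConnected →
    IsGeodesicOn (E := F) (pullbackMetric (F := F) g ι) c J → IsGeodesicOn g (fun t ↦ ι (c t)) J

/-- An integral manifold of the line field spanned by `Z` (a nowhere vanishing vector field): a
smooth map `ι` from a one-dimensional manifold `N` whose differential at each point maps the
tangent space of `N` onto the line spanned by `Z`. As that line is one-dimensional, `ι` is an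
immersion. -/
def IsIntegralManifold {N : Type*} [TopologicalSpace N] [ChartedSpace ℝ N]
    (Z : Π x : M, TangentSpace 𝓘(ℝ, E) x) (ι : N → M) : Prop :=
  ContMDiff 𝓘(ℝ, ℝ) 𝓘(ℝ, E) ∞ ι ∧
    ∀ p : N, LinearMap.range (mfderiv 𝓘(ℝ, ℝ) 𝓘(ℝ, E) ι p).toLinearMap
      = Submodule.span ℝ {Z (ι p)}

/-- The foliation tangent to the nowhere vanishing vector field `Z` is totally geodesic: its
connected integral manifolds are totally geodesic. The leaves are the maximal ones among these;
each connected integral manifold lies in a leaf as an open piece or covers such a piece, and being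
a geodesic is a local property, so that it is the same to ask this of the leaves only. -/
def FoliationIsTotallyGeodesic
    (g : Π x : M, TangentSpace 𝓘(ℝ, E) x →L[ℝ] TangentSpace 𝓘(ℝ, E) x →L[ℝ] ℝ)
    (Z : Π x : M, TangentSpace 𝓘(ℝ, E) x) : Prop :=
  ∀ (N : Type) [TopologicalSpace N] [ChartedSpace ℝ N] [IsManifold 𝓘(ℝ, ℝ) ∞ N]
    [T2Space N] [SecondCountableTopology N] [ConnectedSpace N] (ι : N → M),
    IsIntegralManifold Z ι → IsTotallyGeodesic (F := ℝ) g ι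

end ZFoliation

end

/-!
If `D` is orthogonal to `Z`, then `g(Z, ·) = exp (2h) τ` for a smooth function `h`, so that
`X = exp (-h) Z` is a unit field and `g(X, ·) = exp h • τ`. For every unit field,
`g(∇_X X, ·) = ι_X d(g(X, ·))`; hence the integral curves of `X` are geodesics if and only if
`ι_X d(exp h • τ) = 0`, which is the equation `L_Z τ = dh - dh(Z) τ`. Conversely, for every `h`
some metric satisfies `g(Z, ·) = exp (2h) τ`, so the theorem is about solving this equation.

Put `β = L_Z τ`. Since `χ` is a section of `⋀² ker τ` and `dτ(χ) = -1`, a solution `h` satisfies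
`dβ(χ) = dh(Z)`, so that `β + dβ(χ) τ = dh` is closed. If `β + dβ(χ) τ` is closed, it is `dh` for
some `h` because `M` is simply connected, and evaluating at `Z` shows that `dβ(χ) = dh(Z)`, because
`β(Z) = 0`.
-/

noncomputable section

namespace ZFoliation

variable {E : Type*} [NormedAddCommGroup E] [NormedSpace ℝ E]
  {F : Type*} [NormedAddCommGroup F] [NormedSpace ℝ F]
  {M : Type*} [TopologicalSpace M] [ChartedSpace E M]
  {α β τ : Π x : M, TangentSpace 𝓘(ℝ, E) x →L[ℝ] ℝ}
  {X Z : Π x : M, TangentSpace 𝓘(ℝ, E) x}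
  {g : Π x : M, TangentSpace 𝓘(ℝ, E) x →L[ℝ] TangentSpace 𝓘(ℝ, E) x →L[ℝ] ℝ}
  {x₀ x : M} {y : E}

local notation "φ" => extChartAt 𝓘(ℝ, E)
local notation "𝐓" => mfderiv 𝓘(ℝ, E) 𝓘(ℝ, E)

@[simp]
lemma pullbackBilin_apply {V W : Type*} [AddCommGroup V] [Module ℝ V] [TopologicalSpace V]
    [AddCommGroup W] [Module ℝ W] [TopologicalSpace W] (b : W →L[ℝ] W →L[ℝ] ℝ) (A : V →L[ℝ] W)
    (u v : V) : pullbackBilin b A u v = b (A u) (A v) :=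
  rfl

/-! ### Tensor fields in a chart -/

lemma eventually_mem_extChartAt_target (hx : x ∈ (φ x₀).source) :
    ∀ᶠ y in 𝓝 (φ x₀ x), y ∈ (φ x₀).target :=
  (isOpen_extChartAt_target x₀).mem_nhds ((φ x₀).map_source hx)

lemma oneFormInChart_add (α β : Π x : M, TangentSpace 𝓘(ℝ, E) x →L[ℝ] ℝ) (x₀ : M) :
    oneFormInChart (fun p ↦ α p + β p) x₀ =
      fun y ↦ oneFormInChart α x₀ y + oneFormInChart β x₀ y :=
  rfl

lemma oneFormInChart_smul (u : M → ℝ) (α : Π x : M, TangentSpace 𝓘(ℝ, E) x →L[ℝ] ℝ) (x₀ : M) :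
    oneFormInChart (fun p ↦ u p • α p) x₀ =
      fun y ↦ u ((φ x₀).symm y) • oneFormInChart α x₀ y :=
  rfl

section Charts

variable [IsManifold 𝓘(ℝ, E) ∞ M]

lemma contMDiffAt_extChartAt_symm (hy : y ∈ (φ x₀).target) :
    ContMDiffAt 𝓘(ℝ, E) 𝓘(ℝ, E) ∞ (φ x₀).symm y :=
  (contMDiffOn_extChartAt_symm x₀).contMDiffAt ((isOpen_extChartAt_target x₀).mem_nhds hy)

lemma contMDiffAt_extChartAt_of_mem (hx : x ∈ (φ x₀).source) :
    ContMDiffAt 𝓘(ℝ, E) 𝓘(ℝ, E) ∞ (φ x₀) x :=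
  contMDiffAt_extChartAt' (by simpa using hx)

lemma contMDiffAt_iff_comp_extChartAt_symm (hx : x ∈ (φ x₀).source) {f : M → F} :
    ContMDiffAt 𝓘(ℝ, E) 𝓘(ℝ, F) ∞ f x ↔
      ContDiffAt ℝ ∞ (fun y ↦ f ((φ x₀).symm y)) (φ x₀ x) := by
  rw [contMDiffAt_iff_source_of_mem_source (by simpa using hx), ModelWithCorners.range_eq_univ,
    contMDiffWithinAt_univ, contMDiffAt_iff_contDiffAt]
  rfl

lemma contMDiffAt_iff_of_eqOn_comp_extChartAt (hx : x ∈ (φ x₀).source) {f : M → F} {k : E → F}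
    (hk : ∀ z ∈ (φ x₀).source, f z = k (φ x₀ z)) :
    ContMDiffAt 𝓘(ℝ, E) 𝓘(ℝ, F) ∞ f x ↔ ContDiffAt ℝ ∞ k (φ x₀ x) := by
  rw [contMDiffAt_iff_comp_extChartAt_symm hx]
  suffices h : (fun y ↦ f ((φ x₀).symm y)) =ᶠ[𝓝 (φ x₀ x)] k from
    ⟨fun hf ↦ hf.congr_of_eventuallyEq h.symm, fun hk ↦ hk.congr_of_eventuallyEq h⟩
  filter_upwards [eventually_mem_extChartAt_target hx] with y hy
  rw [hk _ ((φ x₀).map_target hy), (φ x₀).right_inv hy]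

lemma mfderiv_extChartAt_symm_self (x : M) :
    𝐓 (φ x).symm (φ x x) = ContinuousLinearMap.id ℝ E := by
  have h := mfderivWithin_range_extChartAt_symm (I := 𝓘(ℝ, E)) (x := x)
  rwa [ModelWithCorners.range_eq_univ, mfderivWithin_univ] at h

lemma mfderiv_extChartAt_comp_symm (hy : y ∈ (φ x₀).target) :
    (𝐓 (φ x₀) ((φ x₀).symm y)).comp (𝐓 (φ x₀).symm y) = ContinuousLinearMap.id ℝ _ := by
  have h := mfderiv_extChartAt_comp_mfderivWithin_extChartAt_symm (I := 𝓘(ℝ, E)) hy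
  rwa [ModelWithCorners.range_eq_univ, mfderivWithin_univ] at h

lemma mfderiv_extChartAt_symm_comp (hy : y ∈ (φ x₀).target) :
    (𝐓 (φ x₀).symm y).comp (𝐓 (φ x₀) ((φ x₀).symm y)) = ContinuousLinearMap.id ℝ _ := by
  have h := mfderivWithin_extChartAt_symm_comp_mfderiv_extChartAt (I := 𝓘(ℝ, E)) hy
  rwa [ModelWithCorners.range_eq_univ, mfderivWithin_univ] at h

lemma mfderiv_extChartAt_symm_mfderiv (hx : x ∈ (φ x₀).source) (v : TangentSpace 𝓘(ℝ, E) x) :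
    𝐓 (φ x₀).symm (φ x₀ x) (𝐓 (φ x₀) x v) = v := by
  have h := mfderivWithin_extChartAt_symm_comp_mfderiv_extChartAt' (I := 𝓘(ℝ, E)) hx
  rw [ModelWithCorners.range_eq_univ, mfderivWithin_univ] at h
  exact DFunLike.congr_fun h v

lemma oneFormInChart_self (α : Π x : M, TangentSpace 𝓘(ℝ, E) x →L[ℝ] ℝ) (x : M) (v : E) :
    oneFormInChart α x (φ x x) v = α x v := by
  rw [oneFormInChart, mfderiv_extChartAt_symm_self, extChartAt_to_inv]
  rfl

lemma metricInChart_self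
    (g : Π x : M, TangentSpace 𝓘(ℝ, E) x →L[ℝ] TangentSpace 𝓘(ℝ, E) x →L[ℝ] ℝ) (x : M) (v w : E) :
    metricInChart g x (φ x x) v w = g x v w := by
  rw [metricInChart, mfderiv_extChartAt_symm_self, extChartAt_to_inv]
  rfl

lemma vectorFieldInChart_eq (X : Π x : M, TangentSpace 𝓘(ℝ, E) x) (hy : y ∈ (φ x₀).target) :
    vectorFieldInChart X x₀ y = 𝐓 (φ x₀) ((φ x₀).symm y) (X ((φ x₀).symm y)) := by
  rw [vectorFieldInChart, VectorField.mpullback_apply]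
  exact DFunLike.congr_fun (ContinuousLinearMap.inverse_eq (mfderiv_extChartAt_symm_comp hy)
    (mfderiv_extChartAt_comp_symm hy)) _

lemma vectorFieldInChart_extChartAt (X : Π x : M, TangentSpace 𝓘(ℝ, E) x)
    (hx : x ∈ (φ x₀).source) : vectorFieldInChart X x₀ (φ x₀ x) = 𝐓 (φ x₀) x (X x) := by
  rw [vectorFieldInChart_eq X ((φ x₀).map_source hx), (φ x₀).left_inv hx]

lemma vectorFieldInChart_self (X : Π x : M, TangentSpace 𝓘(ℝ, E) x) (x : M) :
    vectorFieldInChart X x (φ x x) = X x := by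
  rw [vectorFieldInChart_extChartAt X (mem_extChartAt_source x), mfderiv_extChartAt_self]
  rfl

lemma mfderiv_symm_vectorFieldInChart (X : Π x : M, TangentSpace 𝓘(ℝ, E) x)
    (hy : y ∈ (φ x₀).target) :
    𝐓 (φ x₀).symm y (vectorFieldInChart (E := E) X x₀ y) = X ((φ x₀).symm y) := by
  rw [vectorFieldInChart_eq X hy]
  exact DFunLike.congr_fun (mfderiv_extChartAt_symm_comp hy) _

lemma oneFormInChart_vectorFieldInChart (α : Π x : M, TangentSpace 𝓘(ℝ, E) x →L[ℝ] ℝ)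
    (X : Π x : M, TangentSpace 𝓘(ℝ, E) x) (hy : y ∈ (φ x₀).target) :
    oneFormInChart α x₀ y (vectorFieldInChart X x₀ y) =
      α ((φ x₀).symm y) (X ((φ x₀).symm y)) := by
  rw [← mfderiv_symm_vectorFieldInChart X hy]
  rfl

lemma contMDiffAt_vectorField_iff (X : Π x : M, TangentSpace 𝓘(ℝ, E) x)
    (hx : x ∈ (φ x₀).source) :
    ContMDiffAt 𝓘(ℝ, E) 𝓘(ℝ, E).tangent ∞
      (fun x ↦ (Bundle.TotalSpace.mk' E x (X x) : TangentBundle 𝓘(ℝ, E) M)) x ↔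
    ContDiffAt ℝ ∞ (vectorFieldInChart X x₀) (φ x₀ x) := by
  have hx' : x ∈ (trivializationAt E (TangentSpace 𝓘(ℝ, E) : M → Type _) x₀).baseSet := by
    simpa using hx
  refine (Bundle.Trivialization.contMDiffAt_section_iff _ hx').trans ?_
  refine contMDiffAt_iff_of_eqOn_comp_extChartAt hx fun z hz ↦ ?_
  rw [vectorFieldInChart_extChartAt X hz]
  refine Eq.trans ?_ (DFunLike.congr_fun (TangentBundle.continuousLinearMapAt_trivializationAt
    (I := 𝓘(ℝ, E)) (by simpa using hz)) (X z))
  rw [Bundle.Trivialization.continuousLinearMapAt_apply,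
    Bundle.Trivialization.coe_linearMapAt_of_mem _ (by simpa using hz)]

lemma contMDiffAt_oneForm_iff (α : Π x : M, TangentSpace 𝓘(ℝ, E) x →L[ℝ] ℝ)
    (hx : x ∈ (φ x₀).source) :
    ContMDiffAt 𝓘(ℝ, E) (𝓘(ℝ, E).prod 𝓘(ℝ, E →L[ℝ] ℝ)) ∞
      (fun x ↦ Bundle.TotalSpace.mk' (E →L[ℝ] ℝ)
        (E := fun x : M ↦ TangentSpace 𝓘(ℝ, E) x →L[ℝ] ℝ) x (α x)) x ↔
    ContDiffAt ℝ ∞ (oneFormInChart α x₀) (φ x₀ x) := by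
  have hx' : x ∈ (trivializationAt (E →L[ℝ] ℝ)
      (fun x : M ↦ TangentSpace 𝓘(ℝ, E) x →L[ℝ] ℝ) x₀).baseSet := by
    rw [hom_trivializationAt_baseSet]
    simpa using hx
  refine (Bundle.Trivialization.contMDiffAt_section_iff _ hx').trans ?_
  refine contMDiffAt_iff_of_eqOn_comp_extChartAt hx fun z hz ↦ ?_
  rw [hom_trivializationAt_apply]
  ext w
  rw [oneFormInChart, ContinuousLinearMap.inCoordinates,
    TangentBundle.symmL_trivializationAt (by simpa using hz), ModelWithCorners.range_eq_univ,
    mfderivWithin_univ, (φ x₀).left_inv hz]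
  simp

lemma metric_trivializationAt_apply (hx : x ∈ (φ x₀).source) (v w : E) :
    (trivializationAt (E →L[ℝ] E →L[ℝ] ℝ)
      (fun x : M ↦ TangentSpace 𝓘(ℝ, E) x →L[ℝ] TangentSpace 𝓘(ℝ, E) x →L[ℝ] ℝ) x₀
      ⟨x, g x⟩).2 v w = metricInChart g x₀ (φ x₀ x) v w := by
  have hb : x ∈ (trivializationAt E (TangentSpace 𝓘(ℝ, E) : M → Type _) x₀).baseSet := by
    simpa using hx
  rw [hom_trivializationAt_apply, inCoordinates_apply_eq₂ hb hb (by simp), metricInChart,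
    (φ x₀).left_inv hx, ← mfderivWithin_univ, ← ModelWithCorners.range_eq_univ 𝓘(ℝ, E),
    ← TangentBundle.symmL_trivializationAt (by simpa using hx), pullbackBilin_apply,
    Bundle.Trivialization.symmL_apply _ hb, Bundle.Trivialization.symmL_apply _ hb]
  simp

set_option synthInstance.maxHeartbeats 100000 in
lemma contMDiffAt_metric_iff
    (g : Π x : M, TangentSpace 𝓘(ℝ, E) x →L[ℝ] TangentSpace 𝓘(ℝ, E) x →L[ℝ] ℝ)
    (hx : x ∈ (φ x₀).source) :
    ContMDiffAt 𝓘(ℝ, E) (𝓘(ℝ, E).prod 𝓘(ℝ, E →L[ℝ] E →L[ℝ] ℝ)) ∞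
      (fun x ↦ Bundle.TotalSpace.mk' (E →L[ℝ] E →L[ℝ] ℝ)
        (E := fun x : M ↦ TangentSpace 𝓘(ℝ, E) x →L[ℝ] TangentSpace 𝓘(ℝ, E) x →L[ℝ] ℝ) x (g x)) x ↔
    ContDiffAt ℝ ∞ (metricInChart g x₀) (φ x₀ x) := by
  have hx' : x ∈ (trivializationAt (E →L[ℝ] E →L[ℝ] ℝ)
      (fun x : M ↦ TangentSpace 𝓘(ℝ, E) x →L[ℝ] TangentSpace 𝓘(ℝ, E) x →L[ℝ] ℝ) x₀).baseSet := by
    rw [hom_trivializationAt_baseSet, hom_trivializationAt_baseSet]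
    simpa using hx
  refine (Bundle.Trivialization.contMDiffAt_section_iff (trivializationAt (E →L[ℝ] E →L[ℝ] ℝ)
      (fun x : M ↦ TangentSpace 𝓘(ℝ, E) x →L[ℝ] TangentSpace 𝓘(ℝ, E) x →L[ℝ] ℝ) x₀) hx').trans ?_
  refine contMDiffAt_iff_of_eqOn_comp_extChartAt hx fun z hz ↦ ?_
  ext v w
  exact metric_trivializationAt_apply hz v w

lemma IsSmoothOneForm.contDiffAt (hα : IsSmoothOneForm α) (hy : y ∈ (φ x₀).target) :
    ContDiffAt ℝ ∞ (oneFormInChart α x₀) y := by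
  rw [← (φ x₀).right_inv hy]
  exact (contMDiffAt_oneForm_iff α ((φ x₀).map_target hy)).1 hα.contMDiffAt

lemma IsSmoothOneForm.differentiableAt (hα : IsSmoothOneForm α) (hy : y ∈ (φ x₀).target) :
    DifferentiableAt ℝ (oneFormInChart α x₀) y :=
  (hα.contDiffAt hy).differentiableAt (by simp)

lemma isSmoothOneForm_iff :
    IsSmoothOneForm α ↔ ∀ x, ContDiffAt ℝ ∞ (oneFormInChart α x) (φ x x) :=
  forall_congr' fun x ↦ contMDiffAt_oneForm_iff α (mem_extChartAt_source x)

lemma IsSmoothVectorFieldOn.contDiffAt {U : Set M} (hX : IsSmoothVectorFieldOn X U)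
    (hy : y ∈ (φ x₀).target) (hU : U ∈ 𝓝 ((φ x₀).symm y)) :
    ContDiffAt ℝ ∞ (vectorFieldInChart X x₀) y := by
  rw [← (φ x₀).right_inv hy]
  exact (contMDiffAt_vectorField_iff X ((φ x₀).map_target hy)).1 (hX.contMDiffAt hU)

lemma IsSmoothVectorField.contDiffAt (hX : IsSmoothVectorField X) (hy : y ∈ (φ x₀).target) :
    ContDiffAt ℝ ∞ (vectorFieldInChart X x₀) y :=
  IsSmoothVectorFieldOn.contDiffAt hX hy Filter.univ_mem

lemma IsSmoothVectorField.differentiableAt (hX : IsSmoothVectorField X)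
    (hy : y ∈ (φ x₀).target) : DifferentiableAt ℝ (vectorFieldInChart X x₀) y :=
  (hX.contDiffAt hy).differentiableAt (by simp)

end Charts

/-! ### The exterior derivative and the Lie derivative of a one-form -/

lemma differentiableAt_ofSubsingleton {a : E → E →L[ℝ] ℝ} (ha : DifferentiableAt ℝ a y) :
    DifferentiableAt ℝ
      (fun y ↦ ContinuousAlternatingMap.ofSubsingleton ℝ E ℝ (0 : Fin 1) (a y)) y :=
  (ContinuousAlternatingMap.ofSubsingletonLIE (𝕜 := ℝ) (E := E) (F := ℝ)
    (0 : Fin 1)).differentiable.differentiableAt.comp y ha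

lemma extDeriv_ofSubsingleton_apply {a : E → E →L[ℝ] ℝ} (ha : DifferentiableAt ℝ a y) (v w : E) :
    extDeriv (fun y ↦ ContinuousAlternatingMap.ofSubsingleton ℝ E ℝ (0 : Fin 1) (a y)) y ![v, w] =
      fderiv ℝ a y v w - fderiv ℝ a y w v := by
  have hfderiv (v w : E) : fderiv ℝ (fun y ↦ a y w) y v = fderiv ℝ a y v w := by
    rw [fderiv_clm_apply ha (differentiableAt_const w)]
    simp
  rw [extDeriv_apply (differentiableAt_ofSubsingleton ha)]
  simp [Fin.sum_univ_two, Fin.removeNth, hfderiv, ← sub_eq_add_neg]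

lemma extD_eq_zero_iff : extD α x = 0 ↔ ∀ v w, extD α x ![v, w] = 0 := by
  refine ⟨fun h v w ↦ by rw [h]; rfl, fun h ↦ ?_⟩
  ext m
  rw [show m = ![m 0, m 1] by ext i; fin_cases i <;> rfl, h]
  rfl

/-- The differential of a function, as a one-form. -/
def diffForm (h : M → ℝ) (x : M) : TangentSpace 𝓘(ℝ, E) x →L[ℝ] ℝ :=
  mfderiv 𝓘(ℝ, E) 𝓘(ℝ, ℝ) h x

lemma evalBivector_sum {V : Type*} [AddCommGroup V] [Module ℝ V] [TopologicalSpace V]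
    {ι : Type*} (s : Finset ι) (η : V [⋀^Fin 2]→L[ℝ] ℝ) (v w : ι → V) :
    evalBivector η (∑ i ∈ s, exteriorPower.ιMulti ℝ 2 ![v i, w i]) =
      ∑ i ∈ s, η ![v i, w i] := by
  rw [evalBivector, map_sum]
  refine Finset.sum_congr rfl fun i _ ↦ ?_
  rw [exteriorPower.alternatingMapLinearEquiv_apply_ιMulti]
  rfl

section Charts

variable [IsManifold 𝓘(ℝ, E) ∞ M]

lemma eventually_extChartAt_symm_mem (hy : y ∈ (φ x₀).target) {U : Set M}
    (hU : U ∈ 𝓝 ((φ x₀).symm y)) : ∀ᶠ z in 𝓝 y, (φ x₀).symm z ∈ U :=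
  (contMDiffAt_extChartAt_symm hy).continuousAt.eventually_mem hU

lemma extD_apply {x : M} (hα : DifferentiableAt ℝ (oneFormInChart α x) (φ x x)) (v w : E) :
    extD α x ![v, w] = fderiv ℝ (oneFormInChart α x) (φ x x) v w
      - fderiv ℝ (oneFormInChart α x) (φ x x) w v := by
  rw [← extDeriv_ofSubsingleton_apply hα, extD, mfderiv_extChartAt_self]
  rfl

lemma contDiffAt_transition (hy : y ∈ (φ x₀).target) (hx : (φ x₀).symm y ∈ (φ x).source) :
    ContDiffAt ℝ ∞ (fun z ↦ φ x ((φ x₀).symm z)) y :=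
  (ContMDiffAt.comp y (contMDiffAt_extChartAt_of_mem hx)
    (contMDiffAt_extChartAt_symm hy)).contDiffAt

lemma fderiv_transition (hy : y ∈ (φ x₀).target) (hx : (φ x₀).symm y ∈ (φ x).source) (v : E) :
    fderiv ℝ (fun z ↦ φ x ((φ x₀).symm z)) y v =
      𝐓 (φ x) ((φ x₀).symm y) (𝐓 (φ x₀).symm y v) := by
  rw [← mfderiv_eq_fderiv]
  exact DFunLike.congr_fun (mfderiv_comp y
    ((contMDiffAt_extChartAt_of_mem hx).mdifferentiableAt (by simp))
    ((contMDiffAt_extChartAt_symm hy).mdifferentiableAt (by simp))) v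

lemma oneFormInChart_eq_comp_fderiv_transition (α : Π x : M, TangentSpace 𝓘(ℝ, E) x →L[ℝ] ℝ)
    (hy : y ∈ (φ x₀).target) (hx : (φ x₀).symm y ∈ (φ x).source) :
    oneFormInChart α x₀ y = (oneFormInChart α x (φ x ((φ x₀).symm y))).comp
      (fderiv ℝ (fun z ↦ φ x ((φ x₀).symm z)) y) := by
  ext v
  rw [ContinuousLinearMap.comp_apply, fderiv_transition hy hx]
  refine Eq.trans ?_ (congrArg (α ((φ x).symm (φ x ((φ x₀).symm y))))
    (mfderiv_extChartAt_symm_mfderiv hx _).symm)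
  rw [(φ x).left_inv hx]
  rfl

lemma extD_apply_mfderiv_symm (hα : IsSmoothOneForm α) (hy : y ∈ (φ x₀).target) (v w : E) :
    extD α ((φ x₀).symm y) ![𝐓 (φ x₀).symm y v, 𝐓 (φ x₀).symm y w] =
      fderiv ℝ (oneFormInChart α x₀) y v w - fderiv ℝ (oneFormInChart α x₀) y w v := by
  set x := (φ x₀).symm y
  have hx : (φ x₀).symm y ∈ (φ x).source := mem_extChartAt_source x
  have hpullback : (fun z ↦ ContinuousAlternatingMap.ofSubsingleton ℝ E ℝ (0 : Fin 1)
      (oneFormInChart α x₀ z)) =ᶠ[𝓝 y] fun z ↦ (ContinuousAlternatingMap.ofSubsingleton ℝ E ℝ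
        (0 : Fin 1) (oneFormInChart α x (φ x ((φ x₀).symm z)))).compContinuousLinearMap
          (fderiv ℝ (fun z ↦ φ x ((φ x₀).symm z)) z) := by
    filter_upwards [(isOpen_extChartAt_target x₀).mem_nhds hy,
      eventually_extChartAt_symm_mem hy (extChartAt_source_mem_nhds (I := 𝓘(ℝ, E)) x)] with z hz hzx
    rw [oneFormInChart_eq_comp_fderiv_transition α hz hzx]
    rfl
  rw [← extDeriv_ofSubsingleton_apply (hα.differentiableAt hy), hpullback.extDeriv_eq,
    extDeriv_pullback (r := ∞) (f := fun z ↦ φ x ((φ x₀).symm z))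
      (differentiableAt_ofSubsingleton (hα.differentiableAt (mem_extChartAt_target x)))
      (contDiffAt_transition hy hx) (by rw [minSmoothness_of_isRCLikeNormedField]; norm_cast)]
  refine congrArg (extDeriv _ _) ?_
  ext i
  fin_cases i
  · exact (fderiv_transition hy hx v).symm
  · exact (fderiv_transition hy hx w).symm

lemma extD_add_apply {x : M} (hα : DifferentiableAt ℝ (oneFormInChart α x) (φ x x))
    (hβ : DifferentiableAt ℝ (oneFormInChart β x) (φ x x)) (v w : E) :
    extD (fun p ↦ α p + β p) x ![v, w] = extD α x ![v, w] + extD β x ![v, w] := by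
  have hαβ : DifferentiableAt ℝ (oneFormInChart (fun p ↦ α p + β p) x) (φ x x) := by
    rw [oneFormInChart_add]
    exact hα.add hβ
  rw [extD_apply hαβ, extD_apply hα, extD_apply hβ, oneFormInChart_add, fderiv_fun_add hα hβ]
  simp only [add_apply]
  ring

lemma oneFormInChart_diffForm {h : M → ℝ} (hy : y ∈ (φ x₀).target)
    (hh : MDifferentiableAt 𝓘(ℝ, E) 𝓘(ℝ, ℝ) h ((φ x₀).symm y)) :
    oneFormInChart (diffForm h) x₀ y = fderiv ℝ (fun y ↦ h ((φ x₀).symm y)) y := by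
  rw [← mfderiv_eq_fderiv]
  exact (mfderiv_comp y hh ((contMDiffAt_extChartAt_symm hy).mdifferentiableAt (by simp))).symm

lemma diffForm_apply {h : M → ℝ} {x : M} (hh : MDifferentiableAt 𝓘(ℝ, E) 𝓘(ℝ, ℝ) h x)
    (v : E) :
    diffForm h x v = fderiv ℝ (fun y ↦ h ((φ x).symm y)) (φ x x) v := by
  rw [← oneFormInChart_diffForm (mem_extChartAt_target x) (by rwa [extChartAt_to_inv])]
  exact (oneFormInChart_self (diffForm h) x v).symm

lemma extD_smul_apply {u : M → ℝ} {x : M} (hu : MDifferentiableAt 𝓘(ℝ, E) 𝓘(ℝ, ℝ) u x)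
    (hα : DifferentiableAt ℝ (oneFormInChart α x) (φ x x)) (v w : E) :
    extD (fun p ↦ u p • α p) x ![v, w] =
      diffForm u x v * α x w - diffForm u x w * α x v + u x * extD α x ![v, w] := by
  have hu' : DifferentiableAt ℝ (fun y ↦ u ((φ x).symm y)) (φ x x) := by
    rw [← mdifferentiableAt_iff_differentiableAt]
    refine MDifferentiableAt.comp (g := u) (φ x x) (by rwa [extChartAt_to_inv])
      ((contMDiffAt_extChartAt_symm (mem_extChartAt_target x)).mdifferentiableAt (by simp))
  have huα : DifferentiableAt ℝ (oneFormInChart (fun p ↦ u p • α p) x) (φ x x) := by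
    rw [oneFormInChart_smul]
    exact hu'.smul hα
  rw [extD_apply huα, extD_apply hα, diffForm_apply hu, diffForm_apply hu, oneFormInChart_smul,
    fderiv_fun_smul hu' hα, ← oneFormInChart_self α, ← oneFormInChart_self α, extChartAt_to_inv]
  simp only [add_apply, smul_apply, ContinuousLinearMap.smulRight_apply, smul_eq_mul]
  ring

lemma isSmoothOneForm_diffForm {h : M → ℝ} (hh : ContMDiff 𝓘(ℝ, E) 𝓘(ℝ, ℝ) ∞ h) :
    IsSmoothOneForm (E := E) (diffForm h) := by
  refine isSmoothOneForm_iff.2 fun x ↦ ?_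
  have hx := mem_extChartAt_source (I := 𝓘(ℝ, E)) x
  refine ContDiffAt.congr_of_eventuallyEq (((contMDiffAt_iff_comp_extChartAt_symm hx).1
    hh.contMDiffAt).fderiv_right (m := ∞) (by simp)) ?_
  filter_upwards [eventually_mem_extChartAt_target hx] with y hy
  exact oneFormInChart_diffForm hy (hh.mdifferentiableAt (by simp))

lemma extD_diffForm {h : M → ℝ} (hh : ContMDiff 𝓘(ℝ, E) 𝓘(ℝ, ℝ) ∞ h) (x : M) :
    extD (E := E) (diffForm h) x = 0 := by
  refine extD_eq_zero_iff.2 fun v w ↦ ?_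
  have hx := mem_extChartAt_source (I := 𝓘(ℝ, E)) x
  have hchart : oneFormInChart (diffForm h) x =ᶠ[𝓝 (φ x x)]
      fderiv ℝ (fun y ↦ h ((φ x).symm y)) := by
    filter_upwards [eventually_mem_extChartAt_target hx] with y hy
    exact oneFormInChart_diffForm hy (hh.mdifferentiableAt (by simp))
  have hsymm : IsSymmSndFDerivAt ℝ (fun y ↦ h ((φ x).symm y)) (φ x x) :=
    ((contMDiffAt_iff_comp_extChartAt_symm hx).1 hh.contMDiffAt).isSymmSndFDerivAt
      (by rw [minSmoothness_of_isRCLikeNormedField]; norm_cast)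
  refine (extD_apply ((isSmoothOneForm_diffForm hh).differentiableAt
    (mem_extChartAt_target x)) v w).trans ?_
  rw [hchart.fderiv_eq, sub_eq_zero]
  exact hsymm.eq v w

lemma IsSmoothOneForm.add (hα : IsSmoothOneForm α) (hβ : IsSmoothOneForm β) :
    IsSmoothOneForm (fun p ↦ α p + β p) := by
  refine isSmoothOneForm_iff.2 fun x ↦ ?_
  rw [oneFormInChart_add]
  exact (hα.contDiffAt (mem_extChartAt_target x)).add (hβ.contDiffAt (mem_extChartAt_target x))

lemma IsSmoothOneForm.smul {u : M → ℝ} (hu : ContMDiff 𝓘(ℝ, E) 𝓘(ℝ, ℝ) ∞ u)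
    (hα : IsSmoothOneForm α) : IsSmoothOneForm (fun p ↦ u p • α p) := by
  refine isSmoothOneForm_iff.2 fun x ↦ ?_
  rw [oneFormInChart_smul]
  exact ((contMDiffAt_iff_comp_extChartAt_symm (mem_extChartAt_source x)).1 hu.contMDiffAt).smul
    (hα.contDiffAt (mem_extChartAt_target x))

lemma IsSmoothOneForm.contMDiff_apply (hα : IsSmoothOneForm α) (hX : IsSmoothVectorField X) :
    ContMDiff 𝓘(ℝ, E) 𝓘(ℝ, ℝ) ∞ (fun x ↦ α x (X x)) := by
  intro x
  have hx := mem_extChartAt_source (I := 𝓘(ℝ, E)) x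
  rw [contMDiffAt_iff_comp_extChartAt_symm hx]
  refine ((hα.contDiffAt (mem_extChartAt_target x)).clm_apply
    (hX.contDiffAt (mem_extChartAt_target x))).congr_of_eventuallyEq ?_
  filter_upwards [eventually_mem_extChartAt_target hx] with y hy
  rw [oneFormInChart_vectorFieldInChart α X hy]

lemma fderiv_apply_extChartAt_symm (hα : IsSmoothOneForm α) (hZ : IsSmoothVectorField Z)
    (hy : y ∈ (φ x₀).target) (w : E) :
    fderiv ℝ (fun y ↦ α ((φ x₀).symm y) (Z ((φ x₀).symm y))) y w =
      fderiv ℝ (oneFormInChart α x₀) y w (vectorFieldInChart Z x₀ y) +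
        oneFormInChart α x₀ y (fderiv ℝ (vectorFieldInChart Z x₀) y w) := by
  have hchart : (fun y ↦ α ((φ x₀).symm y) (Z ((φ x₀).symm y))) =ᶠ[𝓝 y]
      fun y ↦ oneFormInChart α x₀ y (vectorFieldInChart Z x₀ y) := by
    filter_upwards [(isOpen_extChartAt_target x₀).mem_nhds hy] with z hz
    rw [oneFormInChart_vectorFieldInChart α Z hz]
  rw [hchart.fderiv_eq, fderiv_clm_apply (hα.differentiableAt hy) (hZ.differentiableAt hy)]
  exact add_comm _ _

lemma lieDerivOneForm_apply_eq_extD_add_diffForm (hα : IsSmoothOneForm α)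
    (hZ : IsSmoothVectorField Z) (x : M) (w : TangentSpace 𝓘(ℝ, E) x) :
    lieDerivOneForm Z α x w = extD α x ![Z x, w] + diffForm (fun p ↦ α p (Z p)) x w := by
  have hx := mem_extChartAt_target (I := 𝓘(ℝ, E)) x
  have hdiff := (diffForm_apply ((hα.contMDiff_apply hZ).mdifferentiableAt (by simp)) w).trans
    (fderiv_apply_extChartAt_symm hα hZ hx w)
  refine Eq.trans ?_ (congrArg₂ (· + ·) (extD_apply (hα.differentiableAt hx) (Z x) w) hdiff).symm
  rw [lieDerivOneForm, mfderiv_extChartAt_self, vectorFieldInChart_self]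
  change fderiv ℝ (oneFormInChart α x) (φ x x) (Z x) w +
    oneFormInChart α x (φ x x) (fderiv ℝ (vectorFieldInChart Z x) (φ x x) w) = _
  ring

lemma oneFormInChart_lieDerivOneForm (hα : IsSmoothOneForm α) (hZ : IsSmoothVectorField Z)
    (hy : y ∈ (φ x₀).target) :
    oneFormInChart (lieDerivOneForm Z α) x₀ y =
      fderiv ℝ (oneFormInChart α x₀) y (vectorFieldInChart Z x₀ y) +
        (oneFormInChart α x₀ y).comp (fderiv ℝ (vectorFieldInChart Z x₀) y) := by
  ext w
  have hcartan := lieDerivOneForm_apply_eq_extD_add_diffForm hα hZ ((φ x₀).symm y)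
    (𝐓 (φ x₀).symm y w)
  rw [← mfderiv_symm_vectorFieldInChart Z hy, extD_apply_mfderiv_symm hα hy] at hcartan
  have hdiff := DFunLike.congr_fun (oneFormInChart_diffForm hy
    ((hα.contMDiff_apply hZ).mdifferentiableAt (by simp))) w
  rw [fderiv_apply_extChartAt_symm hα hZ hy] at hdiff
  refine hcartan.trans ((congrArg (_ + ·) hdiff).trans ?_)
  rw [add_apply, ContinuousLinearMap.comp_apply]
  ring

lemma isSmoothOneForm_lieDerivOneForm (hα : IsSmoothOneForm α) (hZ : IsSmoothVectorField Z) :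
    IsSmoothOneForm (lieDerivOneForm Z α) := by
  refine isSmoothOneForm_iff.2 fun x ↦ ?_
  have hα' := hα.contDiffAt (mem_extChartAt_target x)
  have hZ' := hZ.contDiffAt (mem_extChartAt_target x)
  refine (((hα'.fderiv_right (m := ∞) (by simp)).clm_apply hZ').add
    (hα'.clm_comp (hZ'.fderiv_right (m := ∞) (by simp)))).congr_of_eventuallyEq ?_
  filter_upwards [eventually_mem_extChartAt_target (mem_extChartAt_source x)] with y hy
  exact oneFormInChart_lieDerivOneForm hα hZ hy

lemma contMDiff_evalBivector_extD (hα : IsSmoothOneForm α)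
    {D : Π x : M, Submodule ℝ (TangentSpace 𝓘(ℝ, E) x)}
    {χ : Π x : M, ⋀[ℝ]^2 (TangentSpace 𝓘(ℝ, E) x)} (hχ : IsSmoothBivectorField D χ) :
    ContMDiff 𝓘(ℝ, E) 𝓘(ℝ, ℝ) ∞ (fun x ↦ evalBivector (extD α x) (χ x)) := by
  intro x
  obtain ⟨U, hU, hxU, k, X, Y, hXY, -, hsum⟩ := hχ x
  have hx := mem_extChartAt_target (I := 𝓘(ℝ, E)) x
  have hUx : U ∈ 𝓝 ((φ x).symm (φ x x)) := by
    rw [extChartAt_to_inv]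
    exact hU.mem_nhds hxU
  have hdα := (hα.contDiffAt hx).fderiv_right (m := ∞) (by simp)
  have hX (i : Fin k) := (hXY i).1.contDiffAt hx hUx
  have hY (i : Fin k) := (hXY i).2.contDiffAt hx hUx
  rw [contMDiffAt_iff_comp_extChartAt_symm (mem_extChartAt_source x)]
  refine ContDiffAt.congr_of_eventuallyEq (ContDiffAt.sum (s := Finset.univ) fun i _ ↦
    ((hdα.clm_apply (hX i)).clm_apply (hY i)).sub ((hdα.clm_apply (hY i)).clm_apply (hX i))) ?_
  filter_upwards [(isOpen_extChartAt_target x).mem_nhds hx, eventually_extChartAt_symm_mem hx hUx]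
    with y hy hyU
  rw [hsum _ hyU, evalBivector_sum]
  refine Finset.sum_congr rfl fun i _ ↦ ?_
  rw [← extD_apply_mfderiv_symm hα hy, mfderiv_symm_vectorFieldInChart (X i) hy,
    mfderiv_symm_vectorFieldInChart (Y i) hy]

end Charts

/-! ### Closed one-forms on simply connected manifolds -/

section Gluing

variable {B : Type*} [TopologicalSpace B] {A ι : Type*} [AddCommGroup A] {U : ι → Set B}
  {f : ι → B → A}

/-- The bundle with discrete fibre `A` whose continuous sections are the functions on `B` which
differ from each `f i` by a locally constant function on `U i`. A section is recorded on `U i` by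
its difference with `f i`; the set `U (idx x)` serves as the reference chart at `x`. -/
def gluingCore [TopologicalSpace A] [DiscreteTopology A] (hU : ∀ i, IsOpen (U i)) (idx : B → ι)
    (hidx : ∀ x, x ∈ U (idx x))
    (hf : ∀ i j, ∀ x ∈ U i ∩ U j, ∀ᶠ z in 𝓝 x, f i z - f j z = f i x - f j x) :
    FiberBundleCore ι B A where
  baseSet := U
  isOpen_baseSet := hU
  indexAt := idx
  mem_baseSet_at := hidx
  coordChange i j x a := a + (f i x - f j x)
  coordChange_self i x _ a := by rw [sub_self, add_zero]
  continuousOn_coordChange i j := by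
    rintro ⟨x, a⟩ ⟨hx, -⟩
    suffices h : (fun p : B × A ↦ p.2 + (f i p.1 - f j p.1)) =ᶠ[𝓝 (x, a)]
        fun _ ↦ a + (f i x - f j x) from (continuousAt_const.congr h.symm).continuousWithinAt
    rw [nhds_prod_eq, nhds_discrete A, Filter.prod_pure]
    refine Filter.eventually_map.2 ?_
    filter_upwards [hf i j x hx] with z hz
    rw [hz]
  coordChange_comp i j k x _ a := by abel

/-- The bundle of `gluingCore` is a covering, hence has a section over a simply connected base. -/
lemma exists_eventually_sub_eq [SimplyConnectedSpace B] [LocallyPathConnectedSpace B]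
    (hU : ∀ i, IsOpen (U i)) (hcover : ∀ x, ∃ i, x ∈ U i)
    (hf : ∀ i j, ∀ x ∈ U i ∩ U j, ∀ᶠ z in 𝓝 x, f i z - f j z = f i x - f j x) :
    ∃ h : B → A, ∀ i, ∀ x ∈ U i, ∀ᶠ z in 𝓝 x, h z - f i z = h x - f i x := by
  let _ : TopologicalSpace A := ⊥
  have : DiscreteTopology A := ⟨rfl⟩
  choose idx hidx using hcover
  let C := gluingCore hU idx hidx hf
  obtain ⟨x₀⟩ : Nonempty B := inferInstance
  have hcov : IsCoveringMap C.proj := FiberBundle.isCoveringMap (F := A) (E := C.Fiber)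
  obtain ⟨s, ⟨-, hs⟩, -⟩ := hcov.existsUnique_continuousMap_lifts (ContinuousMap.id B) x₀
    (⟨x₀, (0 : A)⟩ : C.TotalSpace) rfl
  have hproj (x : B) : (s x).1 = x := congrFun hs x
  let a : B → A := fun x ↦ (s x).2
  refine ⟨fun x ↦ a x + f (idx x) x, fun i x hx ↦ ?_⟩
  have hcoord (z : B) : (C.localTriv i (s z)).2 = a z + (f (idx z) z - f i z) := by
    rw [C.localTriv_apply]
    change a z + (f (idx (s z).1) (s z).1 - f i (s z).1) = _
    rw [hproj]
  have hcont : ContinuousAt (fun z ↦ (C.localTriv i (s z)).2) x := by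
    have hmem : s x ∈ (C.localTriv i).source := by rwa [C.mem_localTriv_source, hproj]
    exact continuous_snd.continuousAt.comp
      (ContinuousAt.comp (f := s) ((C.localTriv i).continuousAt hmem) s.continuous.continuousAt)
  filter_upwards [hcont.eventually_mem ((isOpen_discrete {(C.localTriv i (s x)).2}).mem_nhds rfl)]
    with z hz
  rw [add_sub_assoc, add_sub_assoc, ← hcoord, ← hcoord]
  exact hz

end Gluing

section Charts

variable [IsManifold 𝓘(ℝ, E) ∞ M]

lemma oneFormInChart_comp_mfderiv (α : Π x : M, TangentSpace 𝓘(ℝ, E) x →L[ℝ] ℝ)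
    (hy : y ∈ (φ x₀).target) :
    (oneFormInChart α x₀ y).comp (𝐓 (φ x₀) ((φ x₀).symm y)) = α ((φ x₀).symm y) := by
  ext v
  exact congrArg (α ((φ x₀).symm y)) (DFunLike.congr_fun (mfderiv_extChartAt_symm_comp hy) v)

lemma hasMFDerivAt_iff_hasFDerivAt_comp_extChartAt_symm {f : M → ℝ} (hy : y ∈ (φ x₀).target) :
    HasMFDerivAt 𝓘(ℝ, E) 𝓘(ℝ, ℝ) f ((φ x₀).symm y) (α ((φ x₀).symm y)) ↔
      HasFDerivAt (fun y ↦ f ((φ x₀).symm y)) (oneFormInChart α x₀ y) y := by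
  refine ⟨fun h ↦ (h.comp y ((contMDiffAt_extChartAt_symm hy).mdifferentiableAt
    (by simp)).hasMFDerivAt).hasFDerivAt, fun h ↦ ?_⟩
  have hx := (φ x₀).map_target hy
  rw [← oneFormInChart_comp_mfderiv α hy]
  rw [← (φ x₀).right_inv hy] at h
  have hcomp := h.hasMFDerivAt.comp _
    ((contMDiffAt_extChartAt_of_mem hx).mdifferentiableAt (by simp)).hasMFDerivAt
  rw [(φ x₀).right_inv hy] at hcomp
  refine hcomp.congr_of_eventuallyEq ?_
  filter_upwards [(isOpen_extChartAt_source x₀).mem_nhds hx] with z hz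
  exact congrArg f ((φ x₀).left_inv hz).symm

lemma eventually_sub_eq_of_hasMFDerivAt {f k : M → ℝ} {W : Set M} (hW : IsOpen W)
    (hf : ∀ x ∈ W, HasMFDerivAt 𝓘(ℝ, E) 𝓘(ℝ, ℝ) f x (α x))
    (hk : ∀ x ∈ W, HasMFDerivAt 𝓘(ℝ, E) 𝓘(ℝ, ℝ) k x (α x)) (hx : x ∈ W) :
    ∀ᶠ z in 𝓝 x, f z - k z = f x - k x := by
  have hxt := mem_extChartAt_target (I := 𝓘(ℝ, E)) x
  have hnear : ∀ᶠ y in 𝓝 (φ x x), y ∈ (φ x).target ∧ (φ x).symm y ∈ W :=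
    (eventually_mem_extChartAt_target (mem_extChartAt_source x)).and
      (eventually_extChartAt_symm_mem hxt (by rw [extChartAt_to_inv]; exact hW.mem_nhds hx))
  obtain ⟨r, hr, hball⟩ := Metric.eventually_nhds_iff_ball.1 hnear
  have hderiv : ∀ y ∈ Metric.ball (φ x x) r,
      HasFDerivAt (fun y ↦ f ((φ x).symm y) - k ((φ x).symm y)) (0 : E →L[ℝ] ℝ) y := by
    intro y hy
    obtain ⟨hyt, hyW⟩ := hball y hy
    rw [← sub_self (oneFormInChart α x y)]
    exact ((hasMFDerivAt_iff_hasFDerivAt_comp_extChartAt_symm hyt).1 (hf _ hyW)).sub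
      ((hasMFDerivAt_iff_hasFDerivAt_comp_extChartAt_symm hyt).1 (hk _ hyW))
  filter_upwards [extChartAt_source_mem_nhds (I := 𝓘(ℝ, E)) x,
    (continuousAt_extChartAt (I := 𝓘(ℝ, E)) x).eventually_mem (Metric.ball_mem_nhds _ hr)]
    with z hz hzball
  have hconst := Metric.isOpen_ball.is_const_of_fderiv_eq_zero
    (convex_ball (φ x x) r).isPreconnected
    (fun y hy ↦ (hderiv y hy).differentiableAt.differentiableWithinAt)
    (fun y hy ↦ (hderiv y hy).fderiv) hzball (Metric.mem_ball_self hr)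
  simpa only [(φ x).left_inv hz, extChartAt_to_inv] using hconst

lemma exists_local_primitive (hα : IsSmoothOneForm α) (hdα : ∀ x, extD α x = 0) (x₀ : M) :
    ∃ U : Set M, IsOpen U ∧ x₀ ∈ U ∧ ∃ f : M → ℝ,
      ∀ x ∈ U, HasMFDerivAt 𝓘(ℝ, E) 𝓘(ℝ, ℝ) f x (α x) := by
  obtain ⟨r, hr, hball⟩ := Metric.eventually_nhds_iff_ball.1
    (eventually_mem_extChartAt_target (E := E) (mem_extChartAt_source x₀))
  obtain ⟨f, hf⟩ := (convex_ball (φ x₀ x₀) r).exists_forall_hasFDerivAt_of_fderiv_symmetric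
    Metric.isOpen_ball
    (fun y hy ↦ (hα.differentiableAt (hball y hy)).differentiableWithinAt)
    (fun y hy v w ↦ by
      rw [← sub_eq_zero, ← extD_apply_mfderiv_symm hα (hball y hy), hdα]
      rfl)
  refine ⟨(φ x₀).source ∩ φ x₀ ⁻¹' Metric.ball (φ x₀ x₀) r,
    isOpen_extChartAt_preimage' x₀ Metric.isOpen_ball,
    ⟨mem_extChartAt_source x₀, Metric.mem_ball_self hr⟩, fun x ↦ f (φ x₀ x), ?_⟩
  rintro x ⟨hx, hxball⟩
  rw [← (φ x₀).left_inv hx, hasMFDerivAt_iff_hasFDerivAt_comp_extChartAt_symm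
    ((φ x₀).map_source hx)]
  refine (hf _ hxball).congr_of_eventuallyEq ?_
  filter_upwards [eventually_mem_extChartAt_target hx] with y hy
  rw [(φ x₀).right_inv hy]

lemma contMDiff_of_hasMFDerivAt (hα : IsSmoothOneForm α) {h : M → ℝ}
    (hh : ∀ x, HasMFDerivAt 𝓘(ℝ, E) 𝓘(ℝ, ℝ) h x (α x)) : ContMDiff 𝓘(ℝ, E) 𝓘(ℝ, ℝ) ∞ h := by
  intro x
  have hopen := isOpen_extChartAt_target (I := 𝓘(ℝ, E)) x
  have hderiv : ∀ y ∈ (φ x).target,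
      HasFDerivAt (fun y ↦ h ((φ x).symm y)) (oneFormInChart α x y) y :=
    fun y hy ↦ (hasMFDerivAt_iff_hasFDerivAt_comp_extChartAt_symm hy).1 (hh _)
  rw [contMDiffAt_iff_comp_extChartAt_symm (mem_extChartAt_source x)]
  refine ContDiffOn.contDiffAt ?_ (hopen.mem_nhds (mem_extChartAt_target x))
  rw [contDiffOn_infty_iff_fderiv_of_isOpen hopen]
  refine ⟨fun y hy ↦ (hderiv y hy).differentiableAt.differentiableWithinAt, ContDiffOn.congr
    (fun y hy ↦ (hα.contDiffAt hy).contDiffWithinAt) fun y hy ↦ (hderiv y hy).fderiv⟩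

theorem exists_diffForm_eq [SimplyConnectedSpace M] (hα : IsSmoothOneForm α)
    (hdα : ∀ x, extD α x = 0) :
    ∃ h : M → ℝ, ContMDiff 𝓘(ℝ, E) 𝓘(ℝ, ℝ) ∞ h ∧ ∀ x, diffForm h x = α x := by
  have : LocallyPathConnectedSpace M := ChartedSpace.locallyPathConnectedSpace E M
  choose U hU hxU f hf using exists_local_primitive hα hdα
  obtain ⟨h, hh⟩ := exists_eventually_sub_eq hU (fun x ↦ ⟨x, hxU x⟩) fun i j x hx ↦
    eventually_sub_eq_of_hasMFDerivAt ((hU i).inter (hU j)) (fun z hz ↦ hf i z hz.1)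
      (fun z hz ↦ hf j z hz.2) hx
  have hderiv (x : M) : HasMFDerivAt 𝓘(ℝ, E) 𝓘(ℝ, ℝ) h x (α x) := by
    rw [← add_zero (α x)]
    refine ((hf x x (hxU x)).add (hasMFDerivAt_const (h x - f x x) x)).congr_of_eventuallyEq ?_
    filter_upwards [hh x x (hxU x)] with z hz
    simp [← hz]
  exact ⟨h, contMDiff_of_hasMFDerivAt hα hderiv, fun x ↦ (hderiv x).mfderiv⟩

end Charts

/-! ### The equation `d_{τ ⊗ χ} L_Z τ = 0` -/

/-- The part of the differential of `h` which vanishes on `Z`: the one-form `dh - dh(Z) τ`, for a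
one-form `τ` with `τ(Z) = 1`. -/
def horizontalDiff (τ : Π x : M, TangentSpace 𝓘(ℝ, E) x →L[ℝ] ℝ)
    (Z : Π x : M, TangentSpace 𝓘(ℝ, E) x) (h : M → ℝ) (x : M) : TangentSpace 𝓘(ℝ, E) x →L[ℝ] ℝ :=
  diffForm h x + (-diffForm h x (Z x)) • τ x

section Charts

variable [IsManifold 𝓘(ℝ, E) ∞ M]

lemma lieDerivOneForm_apply_of_apply_eq_one (hτ : IsSmoothOneForm τ) (hZ : IsSmoothVectorField Z)
    (hτZ : ∀ x, τ x (Z x) = 1) (x : M) (w : TangentSpace 𝓘(ℝ, E) x) :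
    lieDerivOneForm Z τ x w = extD τ x ![Z x, w] := by
  rw [lieDerivOneForm_apply_eq_extD_add_diffForm hτ hZ, funext hτZ, diffForm, mfderiv_const]
  exact add_zero _

lemma lieDerivOneForm_apply_self (hτ : IsSmoothOneForm τ) (hZ : IsSmoothVectorField Z)
    (hτZ : ∀ x, τ x (Z x) = 1) (x : M) : lieDerivOneForm Z τ x (Z x) = 0 := by
  rw [lieDerivOneForm_apply_of_apply_eq_one hτ hZ hτZ]
  exact (extD τ x).map_eq_zero_of_eq _ (i := 0) (j := 1) rfl (by simp)

lemma extD_horizontalDiff_apply_of_ker (hτ : IsSmoothOneForm τ) (hZ : IsSmoothVectorField Z)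
    {h : M → ℝ} (hh : ContMDiff 𝓘(ℝ, E) 𝓘(ℝ, ℝ) ∞ h) {v w : TangentSpace 𝓘(ℝ, E) x}
    (hv : τ x v = 0) (hw : τ x w = 0) :
    extD (horizontalDiff τ Z h) x ![v, w] = -diffForm h x (Z x) * extD τ x ![v, w] := by
  have hx := mem_extChartAt_target (I := 𝓘(ℝ, E)) x
  have hdh := isSmoothOneForm_diffForm (E := E) hh
  have hu : ContMDiff 𝓘(ℝ, E) 𝓘(ℝ, ℝ) ∞ (fun p ↦ -diffForm h p (Z p)) :=
    (hdh.contMDiff_apply hZ).neg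
  have hsum := extD_add_apply (hdh.differentiableAt hx) ((hτ.smul hu).differentiableAt hx) v w
  have hsmul := extD_smul_apply (hu.mdifferentiableAt (by simp)) (hτ.differentiableAt hx) v w
  refine hsum.trans ((congrArg₂ (· + ·) (extD_eq_zero_iff.1 (extD_diffForm hh x) v w)
    hsmul).trans ?_)
  rw [hv, hw]
  ring

lemma evalBivector_eq_mul_of_forall_mem {D : Π x : M, Submodule ℝ (TangentSpace 𝓘(ℝ, E) x)}
    {χ : Π x : M, ⋀[ℝ]^2 (TangentSpace 𝓘(ℝ, E) x)} (hχ : IsSmoothBivectorField D χ)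
    {η θ : (TangentSpace 𝓘(ℝ, E) x) [⋀^Fin 2]→L[ℝ] ℝ} {c : ℝ}
    (h : ∀ v ∈ D x, ∀ w ∈ D x, η ![v, w] = c * θ ![v, w]) :
    evalBivector η (χ x) = c * evalBivector θ (χ x) := by
  obtain ⟨U, -, hxU, k, X, Y, -, hD, hsum⟩ := hχ x
  rw [hsum x hxU, evalBivector_sum, evalBivector_sum, Finset.mul_sum]
  exact Finset.sum_congr rfl fun i _ ↦ h _ (hD i x hxU).1 _ (hD i x hxU).2

theorem exists_eq_horizontalDiff_of_dSelector_eq_zero [SimplyConnectedSpace M] {β}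
    (hτ : IsSmoothOneForm τ) (hβ : IsSmoothOneForm β)
    (hτZ : ∀ x, τ x (Z x) = 1) (hβZ : ∀ x, β x (Z x) = 0)
    {D : Π x : M, Submodule ℝ (TangentSpace 𝓘(ℝ, E) x)}
    {χ : Π x : M, ⋀[ℝ]^2 (TangentSpace 𝓘(ℝ, E) x)}
    (hχ : IsSmoothBivectorField D χ) (hd : ∀ x, dSelector τ χ β x = 0) :
    ∃ h : M → ℝ, ContMDiff 𝓘(ℝ, E) 𝓘(ℝ, ℝ) ∞ h ∧ β = horizontalDiff τ Z h := by
  obtain ⟨h, hh, hdh⟩ := exists_diffForm_eq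
    (hβ.add (hτ.smul (contMDiff_evalBivector_extD hβ hχ))) hd
  refine ⟨h, hh, funext fun x ↦ ?_⟩
  have hdhZ : diffForm h x (Z x) = evalBivector (extD β x) (χ x) := by
    rw [hdh]
    simp [hβZ, hτZ]
  ext w
  change _ = diffForm h x w + -diffForm h x (Z x) * τ x w
  rw [hdhZ, hdh]
  change _ = β x w + _ * τ x w + -_ * τ x w
  ring

theorem dSelector_horizontalDiff (hτ : IsSmoothOneForm τ) (hZ : IsSmoothVectorField Z)
    {χ : Π x : M, ⋀[ℝ]^2 (TangentSpace 𝓘(ℝ, E) x)} (hχ : IsSmoothBivectorField (kerForm τ) χ)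
    (hdτχ : ∀ x, evalBivector (extD τ x) (χ x) = -1) {h : M → ℝ}
    (hh : ContMDiff 𝓘(ℝ, E) 𝓘(ℝ, ℝ) ∞ h) (x : M) :
    dSelector τ χ (horizontalDiff τ Z h) x = 0 := by
  have hχh (p : M) : evalBivector (extD (horizontalDiff τ Z h) p) (χ p) = diffForm h p (Z p) := by
    rw [evalBivector_eq_mul_of_forall_mem hχ fun v hv w hw ↦
      extD_horizontalDiff_apply_of_ker hτ hZ hh hv hw, hdτχ]
    ring
  have hsum : (fun p ↦ horizontalDiff τ Z h p + contraction τ χ (extD (horizontalDiff τ Z h)) p) =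
      diffForm h := by
    funext p
    ext w
    rw [contraction, hχh]
    change diffForm h p w + -diffForm h p (Z p) * τ p w + diffForm h p (Z p) * τ p w = _
    ring
  rw [dSelector, hsum]
  exact extD_diffForm hh x

theorem dSelector_lieDerivOneForm_eq_zero_iff [SimplyConnectedSpace M]
    (hτ : IsSmoothOneForm τ) (hZ : IsSmoothVectorField Z) (hτZ : ∀ x, τ x (Z x) = 1)
    {χ : Π x : M, ⋀[ℝ]^2 (TangentSpace 𝓘(ℝ, E) x)} (hχ : IsSmoothBivectorField (kerForm τ) χ)
    (hdτχ : ∀ x, evalBivector (extD τ x) (χ x) = -1) :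
    (∀ x, dSelector τ χ (lieDerivOneForm Z τ) x = 0) ↔
      ∃ h : M → ℝ, ContMDiff 𝓘(ℝ, E) 𝓘(ℝ, ℝ) ∞ h ∧
        lieDerivOneForm Z τ = horizontalDiff τ Z h := by
  refine ⟨exists_eq_horizontalDiff_of_dSelector_eq_zero hτ
    (isSmoothOneForm_lieDerivOneForm hτ hZ) hτZ (lieDerivOneForm_apply_self hτ hZ hτZ) hχ, ?_⟩
  rintro ⟨h, hh, hLh⟩
  rw [hLh]
  exact dSelector_horizontalDiff hτ hZ hχ hdτχ hh

end Charts

/-! ### Riemannian metrics with prescribed orthogonal complement of `Z` -/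

/-- Inner products on a real vector space, as continuous bilinear forms which are symmetric and
positive definite. -/
def IsInnerForm {V : Type*} [AddCommGroup V] [Module ℝ V] [TopologicalSpace V]
    (b : V →L[ℝ] V →L[ℝ] ℝ) : Prop :=
  (∀ v w, b v w = b w v) ∧ ∀ v, v ≠ 0 → 0 < b v v

section InnerForms

variable {V W : Type*} [AddCommGroup V] [Module ℝ V] [TopologicalSpace V]
  [AddCommGroup W] [Module ℝ W] [TopologicalSpace W]

lemma convex_setOf_isInnerForm [ContinuousAdd (V →L[ℝ] ℝ)] [ContinuousConstSMul ℝ (V →L[ℝ] ℝ)] :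
    Convex ℝ {b : V →L[ℝ] V →L[ℝ] ℝ | IsInnerForm b} := by
  rintro b ⟨hbs, hbp⟩ c ⟨hcs, hcp⟩ p q hp hq hpq
  refine ⟨fun v w ↦ ?_, fun v hv ↦ ?_⟩
  · change p * b v w + q * c v w = p * b w v + q * c w v
    rw [hbs, hcs]
  · exact convex_Ioi (0 : ℝ) (hbp v hv) (hcp v hv) hp hq hpq

lemma IsInnerForm.nonneg {b : W →L[ℝ] W →L[ℝ] ℝ} (hb : IsInnerForm b) (v : W) : 0 ≤ b v v := by
  rcases eq_or_ne v 0 with rfl | hv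
  · simp
  · exact (hb.2 v hv).le

lemma IsInnerForm.pullbackBilin {b : W →L[ℝ] W →L[ℝ] ℝ} (hb : IsInnerForm b) {A : V →L[ℝ] W}
    (hA : ∀ v, A v = 0 → v = 0) : IsInnerForm (pullbackBilin b A) :=
  ⟨fun v w ↦ hb.1 (A v) (A w), fun v hv ↦ hb.2 (A v) (mt (hA v) hv)⟩

end InnerForms

lemma isCoercive_of_pos [FiniteDimensional ℝ E] {b : E →L[ℝ] E →L[ℝ] ℝ}
    (hb : ∀ v, v ≠ 0 → 0 < b v v) : IsCoercive b := by
  rcases subsingleton_or_nontrivial E with hE | hE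
  · exact ⟨1, one_pos, fun v ↦ by simp [Subsingleton.elim v 0]⟩
  obtain ⟨u, hu, hmin⟩ := (isCompact_sphere (0 : E) 1).exists_isMinOn
    (NormedSpace.sphere_nonempty.2 zero_le_one) (f := fun v ↦ b v v)
    (b.continuous.clm_apply continuous_id).continuousOn
  refine ⟨b u u, hb u (ne_zero_of_mem_unit_sphere ⟨u, hu⟩), fun v ↦ ?_⟩
  rcases eq_or_ne v 0 with rfl | hv
  · simp
  have hn : ‖v‖ ≠ 0 := norm_ne_zero_iff.2 hv
  have hle : b u u ≤ b (‖v‖⁻¹ • v) (‖v‖⁻¹ • v) := hmin (by simp [norm_smul, hn])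
  have hsmul : b v v = b (‖v‖⁻¹ • v) (‖v‖⁻¹ • v) * ‖v‖ * ‖v‖ := by
    simp only [map_smul, smul_apply, smul_eq_mul]
    field_simp
  rw [hsmul]
  gcongr

lemma isVonNBounded_setOf_apply_self_lt_one {b : E →L[ℝ] E →L[ℝ] ℝ} (hb : IsCoercive b) :
    Bornology.IsVonNBounded ℝ {v : E | b v v < 1} := by
  obtain ⟨C, hC, hCb⟩ := hb
  rw [NormedSpace.isVonNBounded_iff, isBounded_iff_forall_norm_le]
  refine ⟨√C⁻¹, fun v hv ↦ Real.le_sqrt_of_sq_le ?_⟩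
  rw [← one_div, le_div_iff₀' hC]
  linarith [hCb v, Set.mem_ofPred_eq ▸ hv]

lemma exists_isInnerForm (E : Type*) [NormedAddCommGroup E] [NormedSpace ℝ E]
    [FiniteDimensional ℝ E] : ∃ b : E →L[ℝ] E →L[ℝ] ℝ, IsInnerForm b := by
  have h : IsInnerForm (innerSL ℝ (E := EuclideanSpace ℝ (Fin (Module.finrank ℝ E)))) :=
    ⟨fun v w ↦ real_inner_comm w v, fun v hv ↦ real_inner_self_pos.2 hv⟩
  exact ⟨_, h.pullbackBilin (A := (toEuclidean (E := E)).toContinuousLinearMap) (by simp)⟩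

lemma contDiffAt_pullbackBilin {G : F → E →L[ℝ] E →L[ℝ] ℝ} {A : F → E →L[ℝ] E} {z : F}
    (hG : ContDiffAt ℝ ∞ G z) (hA : ContDiffAt ℝ ∞ A z) :
    ContDiffAt ℝ ∞ (fun y ↦ pullbackBilin (G y) (A y)) z := by
  have hprecomp : ContDiff ℝ ∞ (ContinuousLinearMap.compL ℝ E E ℝ).flip := by fun_prop
  exact (hprecomp.contDiffAt.comp z hA).clm_comp (hG.clm_comp hA)

/-- The modification of a bilinear form `b` for which `Z` is orthogonal to the kernel of `τ` and has
square norm `c`, if `τ(Z) = 1`. On the kernel of `τ` it agrees with `b`. -/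
def orthogonalize {V : Type*} [AddCommGroup V] [Module ℝ V] [TopologicalSpace V]
    [IsTopologicalAddGroup V] [ContinuousSMul ℝ V] (b : V →L[ℝ] V →L[ℝ] ℝ) (τ : V →L[ℝ] ℝ)
    (Z : V) (c : ℝ) : V →L[ℝ] V →L[ℝ] ℝ :=
  pullbackBilin b (ContinuousLinearMap.id ℝ V - τ.smulRight Z) + τ.smulRight (c • τ)

section Orthogonalize

variable {V : Type*} [AddCommGroup V] [Module ℝ V] [TopologicalSpace V]
  [IsTopologicalAddGroup V] [ContinuousSMul ℝ V] {b : V →L[ℝ] V →L[ℝ] ℝ} {τ : V →L[ℝ] ℝ}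
  {Z : V} {c : ℝ}

lemma orthogonalize_apply (v w : V) :
    orthogonalize b τ Z c v w = b (v - τ v • Z) (w - τ w • Z) + τ v * (c * τ w) :=
  rfl

lemma orthogonalize_apply_left (hτZ : τ Z = 1) (v : V) :
    orthogonalize b τ Z c Z v = c * τ v := by
  simp [orthogonalize_apply, hτZ]

lemma IsInnerForm.orthogonalize (hb : IsInnerForm b) (hc : 0 < c) :
    IsInnerForm (orthogonalize b τ Z c) := by
  refine ⟨fun v w ↦ ?_, fun v hv ↦ ?_⟩
  · rw [orthogonalize_apply, orthogonalize_apply, hb.1]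
    ring
  · rw [orthogonalize_apply]
    by_cases hτv : τ v = 0
    · simpa [hτv] using hb.2 v hv
    · have hsq : 0 < τ v * (c * τ v) := by
        rw [mul_left_comm]
        exact mul_pos hc (mul_self_pos.2 hτv)
      linarith [hb.nonneg (v - τ v • Z)]

end Orthogonalize

section Charts

variable [IsManifold 𝓘(ℝ, E) ∞ M]

lemma contDiffAt_metricInChart
    (g : Bundle.ContMDiffRiemannianMetric 𝓘(ℝ, E) ∞ E (fun x : M ↦ TangentSpace 𝓘(ℝ, E) x))
    (hy : y ∈ (φ x₀).target) : ContDiffAt ℝ ∞ (metricInChart g.inner x₀) y := by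
  rw [← (φ x₀).right_inv hy]
  exact (contMDiffAt_metric_iff g.inner ((φ x₀).map_target hy)).1 (g.contMDiff _)

lemma metricInChart_pullbackBilin_mfderiv_extChartAt (b : E →L[ℝ] E →L[ℝ] ℝ)
    (hy : y ∈ (φ x₀).target) :
    metricInChart (fun x ↦ pullbackBilin b (𝐓 (φ x₀) x)) x₀ y = b := by
  ext v w
  exact congrArg₂ (fun v w ↦ b v w) (DFunLike.congr_fun (mfderiv_extChartAt_comp_symm hy) v)
    (DFunLike.congr_fun (mfderiv_extChartAt_comp_symm hy) w)

lemma metricInChart_orthogonalize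
    (g : Π x : M, TangentSpace 𝓘(ℝ, E) x →L[ℝ] TangentSpace 𝓘(ℝ, E) x →L[ℝ] ℝ)
    (τ : Π x : M, TangentSpace 𝓘(ℝ, E) x →L[ℝ] ℝ) (Z : Π x : M, TangentSpace 𝓘(ℝ, E) x)
    (f : M → ℝ) (hy : y ∈ (φ x₀).target) :
    metricInChart (fun x ↦ orthogonalize (g x) (τ x) (Z x) (f x)) x₀ y =
      orthogonalize (metricInChart g x₀ y) (oneFormInChart τ x₀ y) (vectorFieldInChart Z x₀ y)
        (f ((φ x₀).symm y)) := by
  have hproj (v : E) : 𝐓 (φ x₀).symm y (v - oneFormInChart τ x₀ y v • vectorFieldInChart Z x₀ y) =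
      𝐓 (φ x₀).symm y v - oneFormInChart τ x₀ y v • Z ((φ x₀).symm y) := by
    refine (map_sub _ _ _).trans (congrArg _ ((map_smul _ _ _).trans (congrArg _ ?_)))
    exact mfderiv_symm_vectorFieldInChart Z hy
  ext v w
  exact congrArg₂ (fun v w ↦ g ((φ x₀).symm y) v w + _) (hproj v).symm (hproj w).symm

lemma contDiffAt_orthogonalize {G : F → E →L[ℝ] E →L[ℝ] ℝ} {a : F → E →L[ℝ] ℝ} {v : F → E}
    {c : F → ℝ} {z : F} (hG : ContDiffAt ℝ ∞ G z) (ha : ContDiffAt ℝ ∞ a z)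
    (hv : ContDiffAt ℝ ∞ v z) (hc : ContDiffAt ℝ ∞ c z) :
    ContDiffAt ℝ ∞ (fun y ↦ orthogonalize (G y) (a y) (v y) (c y)) z :=
  (contDiffAt_pullbackBilin hG (contDiffAt_const.sub (ha.smulRight hv))).add
    (ha.smulRight (hc.smul ha))

variable [FiniteDimensional ℝ E]

set_option synthInstance.maxHeartbeats 400000 in
set_option maxHeartbeats 1000000 in
theorem exists_riemannianMetric [T2Space M] [SigmaCompactSpace M] :
    Nonempty
      (Bundle.ContMDiffRiemannianMetric 𝓘(ℝ, E) ∞ E (fun x : M ↦ TangentSpace 𝓘(ℝ, E) x)) := by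
  obtain ⟨b, hb⟩ := exists_isInnerForm E
  obtain ⟨s, hs⟩ := exists_contMDiffSection_forall_mem_convex_of_local 𝓘(ℝ, E) (n := (⊤ : ℕ∞))
    (F_fiber := E →L[ℝ] E →L[ℝ] ℝ)
    (fun x : M ↦ TangentSpace 𝓘(ℝ, E) x →L[ℝ] TangentSpace 𝓘(ℝ, E) x →L[ℝ] ℝ)
    (fun x ↦ {b | IsInnerForm b}) (fun x ↦ convex_setOf_isInnerForm) fun x₀ ↦ by
      refine ⟨(φ x₀).source, extChartAt_source_mem_nhds x₀,
        fun x ↦ pullbackBilin b (𝐓 (φ x₀) x), fun x hx ↦ ?_, fun x hx ↦ ?_⟩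
      · refine ((contMDiffAt_metric_iff _ hx).2 ?_).contMDiffWithinAt
        refine (contDiffAt_const (c := b)).congr_of_eventuallyEq ?_
        filter_upwards [eventually_mem_extChartAt_target hx] with y hy
        exact metricInChart_pullbackBilin_mfderiv_extChartAt b hy
      · refine hb.pullbackBilin fun v hv ↦ ?_
        rw [← mfderiv_extChartAt_symm_mfderiv hx v]
        exact (congrArg (𝐓 (φ x₀).symm (φ x₀ x)) hv).trans (map_zero _)
  exact ⟨{ inner := fun x ↦ s x
           symm := fun x ↦ (hs x).1
           pos := fun x ↦ (hs x).2
           isVonNBounded := fun x ↦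
            isVonNBounded_setOf_apply_self_lt_one (E := E) (isCoercive_of_pos (hs x).2)
           contMDiff := s.contMDiff }⟩

theorem exists_riemannianMetric_apply_eq_mul [T2Space M] [SigmaCompactSpace M]
    (hτ : IsSmoothOneForm τ) (hZ : IsSmoothVectorField Z) (hτZ : ∀ x, τ x (Z x) = 1) {f : M → ℝ}
    (hf : ContMDiff 𝓘(ℝ, E) 𝓘(ℝ, ℝ) ∞ f) (hf0 : ∀ x, 0 < f x) :
    ∃ g : Bundle.ContMDiffRiemannianMetric 𝓘(ℝ, E) ∞ E (fun x : M ↦ TangentSpace 𝓘(ℝ, E) x),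
      ∀ x v, g.inner x (Z x) v = f x * τ x v := by
  obtain ⟨g⟩ := exists_riemannianMetric (E := E) (M := M)
  have hinner (x : M) : IsInnerForm (orthogonalize (g.inner x) (τ x) (Z x) (f x)) :=
    IsInnerForm.orthogonalize ⟨g.symm x, g.pos x⟩ (hf0 x)
  refine ⟨{ inner := fun x ↦ orthogonalize (g.inner x) (τ x) (Z x) (f x)
            symm := fun x ↦ (hinner x).1
            pos := fun x ↦ (hinner x).2
            isVonNBounded := fun x ↦
              isVonNBounded_setOf_apply_self_lt_one (E := E) (isCoercive_of_pos (hinner x).2)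
            contMDiff := fun x ↦ ?_ }, fun x v ↦ orthogonalize_apply_left (hτZ x) v⟩
  have hx := mem_extChartAt_source (I := 𝓘(ℝ, E)) x
  have hy := mem_extChartAt_target (I := 𝓘(ℝ, E)) x
  refine (contMDiffAt_metric_iff _ hx).2 ?_
  refine (contDiffAt_orthogonalize (contDiffAt_metricInChart g hy) (hτ.contDiffAt hy)
    (hZ.contDiffAt hy)
    ((contMDiffAt_iff_comp_extChartAt_symm hx).1 (hf x))).congr_of_eventuallyEq ?_
  filter_upwards [eventually_mem_extChartAt_target hx] with y hy
  exact metricInChart_orthogonalize g.inner τ Z f hy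

end Charts

/-! ### Geodesics -/

section Curves

variable {c : ℝ → M} {J : Set ℝ} {t : ℝ} {m : ℝ → ℝ}

/-- The velocity `c'(t)` of a curve in a manifold. -/
def velocity (c : ℝ → M) (t : ℝ) : TangentSpace 𝓘(ℝ, E) (c t) :=
  mfderiv 𝓘(ℝ, ℝ) 𝓘(ℝ, E) c t (1 : ℝ)

/-- The left-hand side `g(c'' + Γ(c', c'), w)` of the geodesic equation at time `t`, in the chart
at `c t`. -/
def geodesicDefect (g : Π x : M, TangentSpace 𝓘(ℝ, E) x →L[ℝ] TangentSpace 𝓘(ℝ, E) x →L[ℝ] ℝ)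
    (c : ℝ → M) (t : ℝ) (w : E) : ℝ :=
  metricInChart g (c t) (φ (c t) (c t)) (deriv (deriv fun s ↦ φ (c t) (c s)) t) w
    + christoffel g (c t) (φ (c t) (c t)) (deriv (fun s ↦ φ (c t) (c s)) t)
        (deriv (fun s ↦ φ (c t) (c s)) t) w

/-- The lowered acceleration `g(∇_X X, w)` of the integral curves of `X`, in the chart at `x`. -/
def loweredAcceleration
    (g : Π x : M, TangentSpace 𝓘(ℝ, E) x →L[ℝ] TangentSpace 𝓘(ℝ, E) x →L[ℝ] ℝ)
    (X : Π x : M, TangentSpace 𝓘(ℝ, E) x) (x : M) (w : E) : ℝ :=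
  metricInChart g x (φ x x)
      (fderiv ℝ (vectorFieldInChart X x) (φ x x) (vectorFieldInChart X x (φ x x))) w
    + christoffel g x (φ x x) (vectorFieldInChart X x (φ x x)) (vectorFieldInChart X x (φ x x)) w

lemma isGeodesicOn_iff_geodesicDefect_eq_zero :
    IsGeodesicOn g c J ↔
      ContMDiffOn 𝓘(ℝ, ℝ) 𝓘(ℝ, E) ∞ c J ∧ ∀ t ∈ J, ∀ w : E, geodesicDefect g c t w = 0 :=
  Iff.rfl

set_option synthInstance.maxHeartbeats 400000 in
lemma christoffel_smul_smul
    (g : Π x : M, TangentSpace 𝓘(ℝ, E) x →L[ℝ] TangentSpace 𝓘(ℝ, E) x →L[ℝ] ℝ) (x : M)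
    (y u w : E) (r : ℝ) :
    christoffel g x y (r • u) (r • u) w = r ^ 2 * christoffel g x y u u w := by
  unfold christoffel
  simp only [map_smul, smul_apply, smul_eq_mul]
  ring

lemma deriv_deriv_eq_of_deriv_eq_smul {γ : ℝ → E} {V : E → E}
    (hγ : DifferentiableAt ℝ γ t) (hm : HasDerivAt m 0 t) (hV : DifferentiableAt ℝ V (γ t))
    (h : deriv γ =ᶠ[𝓝 t] fun s ↦ m s • V (γ s)) :
    deriv (deriv γ) t = m t ^ 2 • fderiv ℝ V (γ t) (V (γ t)) := by
  have hVγ : HasDerivAt (fun s ↦ V (γ s)) (fderiv ℝ V (γ t) (deriv γ t)) t :=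
    hV.hasFDerivAt.comp_hasDerivAt t hγ.hasDerivAt
  rw [h.deriv_eq]
  refine (hm.smul hVγ).deriv.trans ?_
  rw [h.self_of_nhds, zero_smul, add_zero, map_smul, smul_smul, sq]

section Charts

variable [IsManifold 𝓘(ℝ, E) ∞ M]

lemma hasDerivAt_extChartAt_comp (hc : MDifferentiableAt 𝓘(ℝ, ℝ) 𝓘(ℝ, E) c t)
    (ht : c t ∈ (φ x₀).source) :
    HasDerivAt (fun s ↦ φ x₀ (c s)) (𝐓 (φ x₀) (c t) (velocity c t) : E) t := by
  obtain ⟨A, hA, hA_one⟩ : ∃ A : ℝ →L[ℝ] E, HasFDerivAt (fun s ↦ φ x₀ (c s)) A t ∧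
      A 1 = 𝐓 (φ x₀) (c t) (velocity c t) :=
    ⟨_, (((contMDiffAt_extChartAt_of_mem ht).mdifferentiableAt (by simp)).hasMFDerivAt.comp t
      hc.hasMFDerivAt).hasFDerivAt, rfl⟩
  exact hA_one ▸ hA.hasDerivAt

lemma contDiffAt_extChartAt_comp (hc : ContMDiffAt 𝓘(ℝ, ℝ) 𝓘(ℝ, E) ∞ c t)
    (ht : c t ∈ (φ x₀).source) : ContDiffAt ℝ ∞ (fun s ↦ φ x₀ (c s)) t :=
  ((contMDiffAt_extChartAt_of_mem ht).comp t hc).contDiffAt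

lemma eventually_extChartAt_comp (hc : ContMDiffAt 𝓘(ℝ, ℝ) 𝓘(ℝ, E) ∞ c t) :
    ∀ᶠ s in 𝓝 t, MDifferentiableAt 𝓘(ℝ, ℝ) 𝓘(ℝ, E) c s ∧ c s ∈ (φ (c t)).source := by
  have hdiff : ∀ᶠ s in 𝓝 t, ContMDiffAt 𝓘(ℝ, ℝ) 𝓘(ℝ, E) 1 c s :=
    (contMDiffAt_iff_contMDiffAt_nhds (I' := 𝓘(ℝ, E)) (by simp)).1 (hc.of_le (by simp))
  filter_upwards [hdiff, hc.continuousAt (extChartAt_source_mem_nhds (I := 𝓘(ℝ, E)) (c t))]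
    with s hs hs'
  exact ⟨hs.mdifferentiableAt (by simp), hs'⟩

lemma oneFormInChart_deriv (α : Π x : M, TangentSpace 𝓘(ℝ, E) x →L[ℝ] ℝ)
    (hc : MDifferentiableAt 𝓘(ℝ, ℝ) 𝓘(ℝ, E) c t) (ht : c t ∈ (φ x₀).source) :
    oneFormInChart α x₀ (φ x₀ (c t)) (deriv (fun s ↦ φ x₀ (c s)) t) = α (c t) (velocity c t) := by
  rw [(hasDerivAt_extChartAt_comp hc ht).deriv]
  have h := DFunLike.congr_fun (oneFormInChart_comp_mfderiv α ((φ x₀).map_source ht))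
  rw [(φ x₀).left_inv ht] at h
  exact h (velocity c t)

lemma hasDerivAt_apply_velocity (hα : IsSmoothOneForm α)
    (hc : ContMDiffAt 𝓘(ℝ, ℝ) 𝓘(ℝ, E) ∞ c t) :
    HasDerivAt (fun s ↦ α (c s) (velocity c s))
      (fderiv ℝ (oneFormInChart α (c t)) (φ (c t) (c t)) (deriv (fun s ↦ φ (c t) (c s)) t)
          (deriv (fun s ↦ φ (c t) (c s)) t)
        + oneFormInChart α (c t) (φ (c t) (c t)) (deriv (deriv fun s ↦ φ (c t) (c s)) t)) t := by
  have hγ := contDiffAt_extChartAt_comp hc (mem_extChartAt_source (c t))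
  have hγ' : DifferentiableAt ℝ (deriv fun s ↦ φ (c t) (c s)) t :=
    ((hγ.fderiv_right (m := ∞) (by simp)).differentiableAt (by simp)).clm_apply
      (differentiableAt_const (1 : ℝ))
  have hαγ : HasDerivAt (fun s ↦ oneFormInChart α (c t) (φ (c t) (c s))) _ t :=
    HasFDerivAt.comp_hasDerivAt (l := oneFormInChart α (c t)) (f := fun s ↦ φ (c t) (c s)) t
      (hα.differentiableAt (mem_extChartAt_target (c t))).hasFDerivAt
      (hγ.differentiableAt (by simp)).hasDerivAt
  refine (hαγ.clm_apply hγ'.hasDerivAt).congr_of_eventuallyEq ?_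
  filter_upwards [eventually_extChartAt_comp hc] with s hs
  exact (oneFormInChart_deriv α hs.1 hs.2).symm

lemma geodesicDefect_eq_sq_mul_loweredAcceleration (hX : IsSmoothVectorField X)
    (hc : ContMDiffAt 𝓘(ℝ, ℝ) 𝓘(ℝ, E) ∞ c t) (hm : HasDerivAt m 0 t)
    (hcX : ∀ᶠ s in 𝓝 t, velocity c s = m s • X (c s)) (w : E) :
    geodesicDefect g c t w = m t ^ 2 * loweredAcceleration g X (c t) w := by
  have hγX : deriv (fun s ↦ φ (c t) (c s)) =ᶠ[𝓝 t]
      fun s ↦ m s • vectorFieldInChart X (c t) (φ (c t) (c s)) := by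
    filter_upwards [eventually_extChartAt_comp hc, hcX] with s hs hsX
    rw [(hasDerivAt_extChartAt_comp hs.1 hs.2).deriv, hsX, vectorFieldInChart_extChartAt X hs.2]
    exact map_smul (𝐓 (φ (c t)) (c s)) (m s) (X (c s))
  have hγ'' := deriv_deriv_eq_of_deriv_eq_smul
    ((contDiffAt_extChartAt_comp hc (mem_extChartAt_source (c t))).differentiableAt (by simp))
    hm (hX.differentiableAt (mem_extChartAt_target (c t))) hγX
  unfold geodesicDefect loweredAcceleration
  rw [hγ'', hγX.self_of_nhds, christoffel_smul_smul, map_smul, smul_apply, smul_eq_mul, mul_add]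

end Charts

end Curves

section Line

variable {N : Type*} [TopologicalSpace N] [ChartedSpace ℝ N]
  {μ : Π q : N, TangentSpace 𝓘(ℝ, ℝ) q →L[ℝ] ℝ} {c : ℝ → N} {t : ℝ}

lemma fderiv_smulRight_apply {a : E → E →L[ℝ] ℝ} {b : E → F} (ha : DifferentiableAt ℝ a y)
    (hb : DifferentiableAt ℝ b y) (u v : E) :
    fderiv ℝ (fun z ↦ (a z).smulRight (b z)) y u v =
      a y v • fderiv ℝ b y u + fderiv ℝ a y u v • b y := by
  have h := ContinuousLinearMap.hasFDerivAt_of_bilinear (ContinuousLinearMap.smulRightL ℝ E F)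
    ha.hasFDerivAt hb.hasFDerivAt
  exact congrArg (fun L ↦ L u v) h.fderiv

lemma geodesicDefect_smulRight_self [IsManifold 𝓘(ℝ, ℝ) ∞ N] (hμ : IsSmoothOneForm μ)
    (hc : ContMDiffAt 𝓘(ℝ, ℝ) 𝓘(ℝ, ℝ) ∞ c t) (w : ℝ) :
    geodesicDefect (fun q ↦ (μ q).smulRight (μ q)) c t w =
      deriv (fun s ↦ μ (c s) (velocity c s)) t * μ (c t) w := by
  have hμt := hμ.differentiableAt (mem_extChartAt_target (c t))
  have hcomm (L : ℝ →L[ℝ] ℝ →L[ℝ] ℝ) (r s : ℝ) : L r s = L s r := by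
    rw [← mul_one r, ← mul_one s, ← smul_eq_mul, ← smul_eq_mul, map_smul, map_smul, map_smul,
      map_smul, smul_apply, smul_apply, smul_comm]
  rw [(hasDerivAt_apply_velocity hμ hc).deriv, ← oneFormInChart_self]
  unfold geodesicDefect christoffel
  have hG : metricInChart (fun q ↦ (μ q).smulRight (μ q)) (c t) =
    fun z ↦ (oneFormInChart μ (c t) z).smulRight (oneFormInChart μ (c t) z) := rfl
  rw [hG, fderiv_smulRight_apply hμt hμt, fderiv_smulRight_apply hμt hμt]
  simp only [add_apply, smul_apply, ContinuousLinearMap.smulRight_apply, smul_eq_mul, hcomm _ w]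
  ring

end Line

section Pullback

variable {N : Type*} [TopologicalSpace N] [ChartedSpace F N] {ι : N → M} {q : N}

/-- The pullback `ι^* α` of a one-form by a map. -/
def pullbackOneForm (α : Π x : M, TangentSpace 𝓘(ℝ, E) x →L[ℝ] ℝ) (ι : N → M) (q : N) :
    TangentSpace 𝓘(ℝ, F) q →L[ℝ] ℝ :=
  (α (ι q)).comp (mfderiv 𝓘(ℝ, F) 𝓘(ℝ, E) ι q)

variable [IsManifold 𝓘(ℝ, E) ∞ M] [IsManifold 𝓘(ℝ, F) ∞ N]

lemma oneFormInChart_pullbackOneForm (α : Π x : M, TangentSpace 𝓘(ℝ, E) x →L[ℝ] ℝ) {q₀ : N}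
    {z : F} (hz : z ∈ (extChartAt 𝓘(ℝ, F) q₀).target)
    (hι : MDifferentiableAt 𝓘(ℝ, F) 𝓘(ℝ, E) ι ((extChartAt 𝓘(ℝ, F) q₀).symm z))
    (hιz : ι ((extChartAt 𝓘(ℝ, F) q₀).symm z) ∈ (φ x₀).source) :
    oneFormInChart (pullbackOneForm α ι) q₀ z =
      (oneFormInChart α x₀ (φ x₀ (ι ((extChartAt 𝓘(ℝ, F) q₀).symm z)))).comp
        (fderiv ℝ (fun z ↦ φ x₀ (ι ((extChartAt 𝓘(ℝ, F) q₀).symm z))) z) := by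
  have hφ := (contMDiffAt_extChartAt_of_mem hιz).mdifferentiableAt (by simp)
  have hψ := (contMDiffAt_extChartAt_symm hz).mdifferentiableAt (by simp)
  have hφι := hφ.hasMFDerivAt.comp _ hι.hasMFDerivAt
  obtain ⟨A, hA, hA_eq⟩ : ∃ A : F →L[ℝ] E,
      HasFDerivAt (fun z ↦ φ x₀ (ι ((extChartAt 𝓘(ℝ, F) q₀).symm z))) A z ∧
      ∀ v, A v = 𝐓 (φ x₀) _ (mfderiv 𝓘(ℝ, F) 𝓘(ℝ, E) ι _
        (mfderiv 𝓘(ℝ, F) 𝓘(ℝ, F) (extChartAt 𝓘(ℝ, F) q₀).symm z v)) :=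
    ⟨_, (hφι.comp z hψ.hasMFDerivAt).hasFDerivAt, fun _ ↦ rfl⟩
  have hα := oneFormInChart_comp_mfderiv α ((φ x₀).map_source hιz)
  rw [(φ x₀).left_inv hιz] at hα
  rw [hA.fderiv]
  refine ContinuousLinearMap.ext fun v ↦ Eq.trans ?_
    (congrArg (oneFormInChart α x₀ _) (hA_eq v)).symm
  exact (DFunLike.congr_fun hα _).symm

lemma IsSmoothOneForm.pullbackOneForm (hα : IsSmoothOneForm α)
    (hι : ContMDiff 𝓘(ℝ, F) 𝓘(ℝ, E) ∞ ι) : IsSmoothOneForm (pullbackOneForm (F := F) α ι) := by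
  refine isSmoothOneForm_iff.2 fun q ↦ ?_
  have hqt := mem_extChartAt_target (I := 𝓘(ℝ, F)) q
  have hchart : ContDiffAt ℝ ∞ (fun z ↦ φ (ι q) (ι ((extChartAt 𝓘(ℝ, F) q).symm z)))
      (extChartAt 𝓘(ℝ, F) q q) :=
    (contMDiffAt_iff_comp_extChartAt_symm (mem_extChartAt_source q)).1
      ((contMDiffAt_extChartAt (x := ι q)).comp q hι.contMDiffAt)
  have hα' : ContDiffAt ℝ ∞
      (fun z ↦ oneFormInChart α (ι q) (φ (ι q) (ι ((extChartAt 𝓘(ℝ, F) q).symm z))))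
      (extChartAt 𝓘(ℝ, F) q q) := by
    refine ContDiffAt.comp _ (hα.contDiffAt ?_) hchart
    rw [extChartAt_to_inv]
    exact mem_extChartAt_target (ι q)
  refine (hα'.clm_comp (hchart.fderiv_right (m := ∞) (by simp))).congr_of_eventuallyEq ?_
  have hsource : ∀ᶠ z in 𝓝 (extChartAt 𝓘(ℝ, F) q q),
      ι ((extChartAt 𝓘(ℝ, F) q).symm z) ∈ (φ (ι q)).source := by
    refine (hι.continuous.continuousAt.comp
      (contMDiffAt_extChartAt_symm hqt).continuousAt).eventually_mem ?_
    rw [Function.comp_apply, extChartAt_to_inv]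
    exact extChartAt_source_mem_nhds (ι q)
  filter_upwards [eventually_mem_extChartAt_target (mem_extChartAt_source q), hsource] with z hz hιz
  exact oneFormInChart_pullbackOneForm α hz (hι.mdifferentiable (by simp) _) hιz

end Pullback

section Leaves

variable {N : Type*} [TopologicalSpace N] [ChartedSpace ℝ N] {ι : N → M}
  {θ : Π x : M, TangentSpace 𝓘(ℝ, E) x →L[ℝ] ℝ} {c : ℝ → N} {J : Set ℝ} {t : ℝ}

lemma velocity_comp (hι : MDifferentiableAt 𝓘(ℝ, ℝ) 𝓘(ℝ, E) ι (c t))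
    (hc : MDifferentiableAt 𝓘(ℝ, ℝ) 𝓘(ℝ, ℝ) c t) :
    velocity (fun s ↦ ι (c s)) t = mfderiv 𝓘(ℝ, ℝ) 𝓘(ℝ, E) ι (c t) (velocity c t) :=
  DFunLike.congr_fun (hι.hasMFDerivAt.comp t hc.hasMFDerivAt).mfderiv (1 : ℝ)

namespace IsIntegralManifold

lemma mfderiv_eq (hι : IsIntegralManifold X ι) (hθX : ∀ x, θ x (X x) = 1) (q : N)
    (u : TangentSpace 𝓘(ℝ, ℝ) q) :
    mfderiv 𝓘(ℝ, ℝ) 𝓘(ℝ, E) ι q u = pullbackOneForm (F := ℝ) θ ι q u • X (ι q) := by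
  have hu : mfderiv 𝓘(ℝ, ℝ) 𝓘(ℝ, E) ι q u ∈ Submodule.span ℝ {X (ι q)} :=
    hι.2 q ▸ LinearMap.mem_range_self _ u
  obtain ⟨k, hk⟩ := Submodule.mem_span_singleton.1 hu
  change _ = θ (ι q) (mfderiv 𝓘(ℝ, ℝ) 𝓘(ℝ, E) ι q u) • X (ι q)
  rw [← hk, map_smul, hθX, smul_eq_mul, mul_one]

lemma pullbackOneForm_apply_ne_zero (hι : IsIntegralManifold X ι) (hθX : ∀ x, θ x (X x) = 1)
    (q : N) : pullbackOneForm (F := ℝ) θ ι q (1 : ℝ) ≠ 0 := by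
  intro h
  obtain ⟨r, hr⟩ : X (ι q) ∈ LinearMap.range (mfderiv 𝓘(ℝ, ℝ) 𝓘(ℝ, E) ι q).toLinearMap :=
    hι.2 q ▸ Submodule.mem_span_singleton_self _
  have hr0 : pullbackOneForm (F := ℝ) θ ι q r = 0 := by
    have hpull : ∀ L : ℝ →L[ℝ] ℝ, L 1 = 0 → ∀ s, L s = 0 := fun L hL s ↦ by
      rw [← mul_one s, ← smul_eq_mul, map_smul, hL, smul_zero]
    exact hpull _ h r
  have hX1 : θ (ι q) (X (ι q)) = 0 := (congrArg (θ (ι q)) hr.symm).trans hr0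
  exact one_ne_zero ((hθX (ι q)).symm.trans hX1)

lemma pullbackMetric_eq (hι : IsIntegralManifold X ι) (hX : ∀ x, g x (X x) (X x) = 1) :
    pullbackMetric (F := ℝ) g ι = fun q ↦
      (pullbackOneForm (F := ℝ) (fun x ↦ g x (X x)) ι q).smulRight
        (pullbackOneForm (F := ℝ) (fun x ↦ g x (X x)) ι q) := by
  refine funext fun q ↦ ContinuousLinearMap.ext fun u ↦ ContinuousLinearMap.ext fun v ↦ ?_
  have h := hι.mfderiv_eq hX q u
  refine (congrArg (fun r ↦ g (ι q) r (mfderiv 𝓘(ℝ, ℝ) 𝓘(ℝ, E) ι q v)) h).trans ?_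
  rw [map_smul]
  rfl

variable [IsManifold 𝓘(ℝ, E) ∞ M] [IsManifold 𝓘(ℝ, ℝ) ∞ N]

lemma isGeodesicOn_iff_deriv_velocity_eq_zero (hι : IsIntegralManifold X ι)
    (hX : ∀ x, g x (X x) (X x) = 1) (hθ : IsSmoothOneForm fun x ↦ g x (X x)) (hJ : IsOpen J) :
    IsGeodesicOn (E := ℝ) (pullbackMetric (F := ℝ) g ι) c J ↔
      ContMDiffOn 𝓘(ℝ, ℝ) 𝓘(ℝ, ℝ) ∞ c J ∧ ∀ t ∈ J, deriv (fun s ↦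
        pullbackOneForm (F := ℝ) (fun x ↦ g x (X x)) ι (c s) (velocity c s)) t = 0 := by
  rw [isGeodesicOn_iff_geodesicDefect_eq_zero, hι.pullbackMetric_eq hX]
  refine and_congr_right fun hc ↦ forall₂_congr fun t ht ↦ ?_
  have hdefect := geodesicDefect_smulRight_self (hθ.pullbackOneForm hι.1)
    (hc.contMDiffAt (hJ.mem_nhds ht))
  refine ⟨fun h ↦ ?_, fun h w ↦ by rw [hdefect w, h, zero_mul]⟩
  exact (mul_eq_zero.1 ((hdefect 1).symm.trans (h 1))).resolve_right
    (hι.pullbackOneForm_apply_ne_zero hX (c t))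

end IsIntegralManifold

end Leaves

/-! ### Foliations by curves -/

section Foliations

variable {f : M → ℝ} {N : Type*} [TopologicalSpace N] [ChartedSpace ℝ N] {ι : N → M}

lemma isIntegralManifold_smul_iff (hf : ∀ x, f x ≠ 0) :
    IsIntegralManifold (fun x ↦ f x • Z x) ι ↔ IsIntegralManifold Z ι := by
  simp only [IsIntegralManifold, Submodule.span_singleton_smul_eq (IsUnit.mk0 _ (hf _))]

lemma foliationIsTotallyGeodesic_smul_iff (hf : ∀ x, f x ≠ 0) :
    FoliationIsTotallyGeodesic g (fun x ↦ f x • Z x) ↔ FoliationIsTotallyGeodesic g Z := by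
  simp only [FoliationIsTotallyGeodesic, isIntegralManifold_smul_iff hf]

variable [IsManifold 𝓘(ℝ, E) ∞ M]

lemma foliationIsTotallyGeodesic_of_loweredAcceleration_eq_zero (hX : IsSmoothVectorField X)
    (hunit : ∀ x, g x (X x) (X x) = 1) (hgX : IsSmoothOneForm fun x ↦ g x (X x))
    (hacc : ∀ x w, loweredAcceleration g X x w = 0) : FoliationIsTotallyGeodesic g X := by
  intro N _ _ _ _ _ _ ι hι J c hJ _ hc
  rw [hι.isGeodesicOn_iff_deriv_velocity_eq_zero hunit hgX hJ] at hc
  refine ⟨hι.1.comp_contMDiffOn hc.1, fun t ht w ↦ ?_⟩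
  have hct := hc.1.contMDiffAt (hJ.mem_nhds ht)
  have hspeed :=
    (hasDerivAt_apply_velocity (hgX.pullbackOneForm hι.1) hct).differentiableAt.hasDerivAt
  rw [hc.2 t ht] at hspeed
  have hvelocity : ∀ᶠ s in 𝓝 t, velocity (fun s ↦ ι (c s)) s =
      pullbackOneForm (F := ℝ) (fun x ↦ g x (X x)) ι (c s) (velocity c s) • X (ι (c s)) := by
    filter_upwards [eventually_extChartAt_comp hct] with s hs
    rw [velocity_comp (hι.1.mdifferentiable (by simp) _) hs.1]
    exact hι.mfderiv_eq hunit _ _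
  refine (geodesicDefect_eq_sq_mul_loweredAcceleration hX (hι.1.contMDiffAt.comp t hct) hspeed
    hvelocity w).trans ?_
  rw [hacc, mul_zero]

end Foliations

section IntegralCurves

lemma contDiffOn_of_forall_hasDerivAt {V : E → E} {U : Set E} (hV : ContDiffOn ℝ ∞ V U)
    {γ : ℝ → E} {J : Set ℝ} (hJ : IsOpen J) (hγU : Set.MapsTo γ J U)
    (hγ : ∀ t ∈ J, HasDerivAt γ (V (γ t)) t) : ContDiffOn ℝ ∞ γ J := by
  refine contDiffOn_infty.2 fun n ↦ ?_
  induction n with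
  | zero => exact contDiffOn_zero.2 fun t ht ↦ (hγ t ht).continuousAt.continuousWithinAt
  | succ n ih =>
    refine (contDiffOn_succ_iff_deriv_of_isOpen hJ).2
      ⟨fun t ht ↦ (hγ t ht).differentiableAt.differentiableWithinAt,
        fun h ↦ absurd h (WithTop.natCast_ne_top n), ?_⟩
    exact ((hV.of_le (by exact_mod_cast le_top)).comp ih hγU).congr fun t ht ↦ (hγ t ht).deriv

lemma exists_contDiffOn_integralCurve [CompleteSpace E] {V : E → E} {U : Set E} (hU : IsOpen U)
    (hV : ContDiffOn ℝ ∞ V U) (hy : y ∈ U) :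
    ∃ ε > 0, ∃ γ : ℝ → E, γ 0 = y ∧ Set.MapsTo γ (Metric.ball 0 ε) U ∧
      (∀ t ∈ Metric.ball 0 ε, HasDerivAt γ (V (γ t)) t) ∧ ContDiffOn ℝ ∞ γ (Metric.ball 0 ε) := by
  obtain ⟨r, hr, ε, hε, hsolution⟩ :=
    ((hV.contDiffAt (hU.mem_nhds hy)).of_le (m := 1)
      (by simp)).exists_forall_mem_closedBall_exists_eq_forall_mem_Ioo_hasDerivAt (0 : ℝ)
  obtain ⟨γ, hγ₀, hγ⟩ := hsolution y (Metric.mem_closedBall_self hr.le)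
  rw [← Real.ball_eq_Ioo] at hγ
  have hcont : ContinuousAt γ 0 := (hγ 0 (Metric.mem_ball_self hε)).continuousAt
  obtain ⟨δ, hδ, hδU⟩ := Metric.mem_nhds_iff.1 (hcont.preimage_mem_nhds (hγ₀ ▸ hU.mem_nhds hy))
  have hγU : Set.MapsTo γ (Metric.ball 0 (min ε δ)) U := fun t ht ↦
    hδU (Metric.ball_subset_ball (min_le_right _ _) ht)
  have hγ' : ∀ t ∈ Metric.ball (0 : ℝ) (min ε δ), HasDerivAt γ (V (γ t)) t := fun t ht ↦
    hγ t (Metric.ball_subset_ball (min_le_left _ _) ht)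
  exact ⟨min ε δ, lt_min hε hδ, γ, hγ₀, hγU, hγ',
    contDiffOn_of_forall_hasDerivAt hV Metric.isOpen_ball hγU hγ'⟩

lemma exists_reparametrization_ball {ε : ℝ} (hε : 0 < ε) :
    ∃ e ρ : ℝ → ℝ, ContDiff ℝ ∞ e ∧ (∀ q, e q ∈ Metric.ball 0 ε ∧ deriv e q ≠ 0) ∧
      ContDiffOn ℝ ∞ ρ (Metric.ball 0 ε) ∧
      ∀ t ∈ Metric.ball 0 ε, e (ρ t) = t ∧ deriv ρ t * deriv e (ρ t) = 1 := by
  let e := OpenPartialHomeomorph.univBall (0 : ℝ) ε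
  have he_source (q : ℝ) : q ∈ e.source :=
    OpenPartialHomeomorph.univBall_source (0 : ℝ) ε ▸ Set.mem_univ q
  have he_target : e.target = Metric.ball 0 ε := OpenPartialHomeomorph.univBall_target _ hε
  have he_mem (q : ℝ) : e q ∈ Metric.ball (0 : ℝ) ε := he_target ▸ e.map_source (he_source q)
  have he : ContDiff ℝ ∞ e := OpenPartialHomeomorph.contDiff_univBall
  have he_symm : ContDiffOn ℝ ∞ e.symm (Metric.ball 0 ε) :=
    OpenPartialHomeomorph.contDiffOn_univBall_symm
  have he_right {t : ℝ} (ht : t ∈ Metric.ball (0 : ℝ) ε) : e (e.symm t) = t :=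
    e.right_inv (he_target ▸ ht)
  have hmul : ∀ t ∈ Metric.ball (0 : ℝ) ε, deriv e.symm t * deriv e (e.symm t) = 1 := by
    intro t ht
    have hball := Metric.isOpen_ball.mem_nhds ht
    have hcomp := (he.differentiable (by simp) _).hasDerivAt.comp t
      ((he_symm.contDiffAt hball).differentiableAt (by simp)).hasDerivAt
    rw [mul_comm]
    refine hcomp.unique ((hasDerivAt_id t).congr_of_eventuallyEq ?_)
    filter_upwards [hball] with r hr using he_right hr
  refine ⟨e, e.symm, he, fun q ↦ ⟨he_mem q, ?_⟩, he_symm, fun t ht ↦ ⟨he_right ht, hmul t ht⟩⟩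
  have h := right_ne_zero_of_mul_eq_one (hmul (e q) (he_mem q))
  rwa [e.left_inv (he_source q)] at h

lemma mfderiv_apply_eq_smul_velocity (c : ℝ → M) (t r : ℝ) :
    mfderiv 𝓘(ℝ, ℝ) 𝓘(ℝ, E) c t r = r • velocity c t := by
  refine Eq.trans ?_ (map_smul (mfderiv 𝓘(ℝ, ℝ) 𝓘(ℝ, E) c t) r (1 : ℝ))
  exact congrArg (mfderiv 𝓘(ℝ, ℝ) 𝓘(ℝ, E) c t) (mul_one r).symm

lemma velocity_comp_real {c : ℝ → M} {ρ : ℝ → ℝ} {t : ℝ}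
    (hc : MDifferentiableAt 𝓘(ℝ, ℝ) 𝓘(ℝ, E) c (ρ t)) (hρ : DifferentiableAt ℝ ρ t) :
    velocity (E := E) (fun s ↦ c (ρ s)) t = deriv ρ t • velocity c (ρ t) := by
  have hρ' : velocity (E := ℝ) ρ t = deriv ρ t :=
    DFunLike.congr_fun (mfderiv_eq_fderiv (f := ρ)) (1 : ℝ)
  rw [velocity_comp hc hρ.mdifferentiableAt, hρ']
  exact mfderiv_apply_eq_smul_velocity c (ρ t) (deriv ρ t)

lemma isIntegralManifold_of_velocity_eq_smul {ι : ℝ → M} {b : ℝ → ℝ}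
    (hι : ContMDiff 𝓘(ℝ, ℝ) 𝓘(ℝ, E) ∞ ι) (hb : ∀ q, b q ≠ 0)
    (hιX : ∀ q, velocity ι q = b q • X (ι q)) : IsIntegralManifold X ι := by
  refine ⟨hι, fun q ↦ ?_⟩
  rw [← Submodule.span_singleton_smul_eq (IsUnit.mk0 _ (hb q)), ← hιX]
  refine Submodule.ext fun v ↦ ?_
  rw [Submodule.mem_span_singleton]
  exact exists_congr fun r ↦ Eq.congr_left (mfderiv_apply_eq_smul_velocity ι q r)

section Charts

variable [IsManifold 𝓘(ℝ, E) ∞ M] [CompleteSpace E]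

lemma exists_contMDiffOn_velocity_eq (hX : IsSmoothVectorField X) (x : M) :
    ∃ ε > 0, ∃ γ : ℝ → M, γ 0 = x ∧ ContMDiffOn 𝓘(ℝ, ℝ) 𝓘(ℝ, E) ∞ γ (Metric.ball 0 ε) ∧
      ∀ t ∈ Metric.ball 0 ε, velocity γ t = X (γ t) := by
  have hXc : ContDiffOn ℝ ∞ (vectorFieldInChart X x) (φ x).target := fun y hy ↦
    (hX.contDiffAt hy).contDiffWithinAt
  obtain ⟨ε, hε, γ, hγ₀, hγt, hγ, hγs⟩ := exists_contDiffOn_integralCurve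
    (isOpen_extChartAt_target x) hXc (mem_extChartAt_target (I := 𝓘(ℝ, E)) x)
  refine ⟨ε, hε, fun s ↦ (φ x).symm (γ s), (congrArg (φ x).symm hγ₀).trans (extChartAt_to_inv x),
    fun t ht ↦ ?_, fun t ht ↦ ?_⟩
  · exact ContMDiffAt.comp_contMDiffWithinAt t (g := (φ x).symm) (f := γ)
      (contMDiffAt_extChartAt_symm (hγt ht)) (hγs t ht).contMDiffWithinAt
  · have hcomp := HasMFDerivAt.comp t (g := (φ x).symm) (f := γ)
      ((contMDiffAt_extChartAt_symm (hγt ht)).mdifferentiableAt (by simp)).hasMFDerivAt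
      (hγ t ht).hasFDerivAt.hasMFDerivAt
    refine (DFunLike.congr_fun hcomp.mfderiv (1 : ℝ)).trans ?_
    refine (congrArg (𝐓 (φ x).symm (γ t)) (one_smul ℝ (vectorFieldInChart X x (γ t)))).trans ?_
    exact mfderiv_symm_vectorFieldInChart X (hγt ht)

/-- An integral curve may exist for a short time only: `ι` spreads it over the whole line, and `ρ`
recovers its original parameter. -/
lemma exists_isIntegralManifold (hX : IsSmoothVectorField X) (x : M) :
    ∃ ι : ℝ → M, IsIntegralManifold X ι ∧ ∃ ε > 0, ∃ ρ : ℝ → ℝ, ι (ρ 0) = x ∧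
      ContDiffOn ℝ ∞ ρ (Metric.ball 0 ε) ∧
      ∀ t ∈ Metric.ball 0 ε, velocity (fun s ↦ ι (ρ s)) t = X (ι (ρ t)) := by
  obtain ⟨ε, hε, γ, hγ₀, hγ, hγX⟩ := exists_contMDiffOn_velocity_eq hX x
  obtain ⟨e, ρ, he, he', hρ, heρ⟩ := exists_reparametrization_ball hε
  have hγ_at (q : ℝ) : ContMDiffAt 𝓘(ℝ, ℝ) 𝓘(ℝ, E) ∞ γ (e q) :=
    hγ.contMDiffAt (Metric.isOpen_ball.mem_nhds (he' q).1)
  have hι : ContMDiff 𝓘(ℝ, ℝ) 𝓘(ℝ, E) ∞ fun q ↦ γ (e q) := fun q ↦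
    (hγ_at q).comp q he.contMDiff.contMDiffAt
  have hvelocity (q : ℝ) : velocity (fun q ↦ γ (e q)) q = deriv e q • X (γ (e q)) := by
    rw [velocity_comp_real ((hγ_at q).mdifferentiableAt (by simp))
      (he.differentiable (by simp) q), hγX _ (he' q).1]
  refine ⟨_, isIntegralManifold_of_velocity_eq_smul hι (fun q ↦ (he' q).2) hvelocity, ε, hε, ρ, ?_,
    hρ, fun t ht ↦ ?_⟩
  · rw [(heρ 0 (Metric.mem_ball_self hε)).1, hγ₀]
  · have hρt := (hρ.contDiffAt (Metric.isOpen_ball.mem_nhds ht)).differentiableAt (by simp)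
    rw [velocity_comp_real (c := fun q ↦ γ (e q)) (hι.mdifferentiable (by simp) _) hρt,
      hvelocity, smul_smul, (heρ t ht).2, one_smul]

lemma loweredAcceleration_eq_zero_of_foliationIsTotallyGeodesic (hX : IsSmoothVectorField X)
    (hunit : ∀ x, g x (X x) (X x) = 1) (hgX : IsSmoothOneForm fun x ↦ g x (X x))
    (hg : FoliationIsTotallyGeodesic g X) (x : M) (w : E) : loweredAcceleration g X x w = 0 := by
  obtain ⟨ι, hι, ε, hε, ρ, hιx, hρ, hvelocity⟩ := exists_isIntegralManifold hX x
  have hball {t : ℝ} (ht : t ∈ Metric.ball (0 : ℝ) ε) := Metric.isOpen_ball.mem_nhds ht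
  have hρ_geodesic : IsGeodesicOn (E := ℝ) (pullbackMetric (F := ℝ) g ι) ρ (Metric.ball 0 ε) := by
    rw [hι.isGeodesicOn_iff_deriv_velocity_eq_zero hunit hgX Metric.isOpen_ball]
    refine ⟨hρ.contMDiffOn, fun t ht ↦ ?_⟩
    have hspeed : (fun s ↦ pullbackOneForm (F := ℝ) (fun x ↦ g x (X x)) ι (ρ s) (velocity ρ s))
        =ᶠ[𝓝 t] fun _ ↦ 1 := by
      filter_upwards [hball ht] with s hs
      have hρs := (hρ.contDiffAt (hball hs)).differentiableAt (by simp)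
      refine (congrArg (g (ι (ρ s)) (X (ι (ρ s)))) ?_).trans (hunit (ι (ρ s)))
      rw [← hvelocity s hs, velocity_comp (hι.1.mdifferentiable (by simp) _) hρs.mdifferentiableAt]
      rfl
    rw [hspeed.deriv_eq, deriv_const]
  have h₀ : (0 : ℝ) ∈ Metric.ball (0 : ℝ) ε := Metric.mem_ball_self hε
  have hgeodesic := hg ℝ ι hι _ _ Metric.isOpen_ball
    (Real.ball_eq_Ioo 0 ε ▸ Set.ordConnected_Ioo) hρ_geodesic
  have hdefect := geodesicDefect_eq_sq_mul_loweredAcceleration (g := g) (m := fun _ ↦ 1) hX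
    (hgeodesic.1.contMDiffAt (hball h₀)) (hasDerivAt_const 0 1)
    (by filter_upwards [hball h₀] with s hs using by rw [one_smul, hvelocity s hs]) w
  rw [one_pow, one_mul, hιx] at hdefect
  exact hdefect.symm.trans (hgeodesic.2 0 h₀ w)

lemma foliationIsTotallyGeodesic_iff_loweredAcceleration_eq_zero (hX : IsSmoothVectorField X)
    (hunit : ∀ x, g x (X x) (X x) = 1) (hgX : IsSmoothOneForm fun x ↦ g x (X x)) :
    FoliationIsTotallyGeodesic g X ↔ ∀ x w, loweredAcceleration g X x w = 0 :=
  ⟨loweredAcceleration_eq_zero_of_foliationIsTotallyGeodesic hX hunit hgX,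
    foliationIsTotallyGeodesic_of_loweredAcceleration_eq_zero hX hunit hgX⟩

end Charts

end IntegralCurves

/-! ### Unit vector fields -/

section UnitField

lemma acceleration_eq_of_apply_self_eq_one {G : E → E →L[ℝ] E →L[ℝ] ℝ} {V : E → E}
    (hG : DifferentiableAt ℝ G y) (hV : DifferentiableAt ℝ V y)
    (hsymm : ∀ v w, G y v w = G y w v) (hunit : (fun z ↦ G z (V z) (V z)) =ᶠ[𝓝 y] fun _ ↦ 1)
    (w : E) :
    G y (fderiv ℝ V y (V y)) w + (fderiv ℝ G y (V y) (V y) w + fderiv ℝ G y (V y) (V y) w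
        - fderiv ℝ G y w (V y) (V y)) / 2 =
      fderiv ℝ (fun z ↦ G z (V z)) y (V y) w - fderiv ℝ (fun z ↦ G z (V z)) y w (V y) := by
  have hGV (v w : E) : fderiv ℝ (fun z ↦ G z (V z)) y v w =
      fderiv ℝ G y v (V y) w + G y (fderiv ℝ V y v) w := by
    rw [fderiv_clm_apply hG hV]
    exact add_comm _ _
  have hGVV := DFunLike.congr_fun (hunit.fderiv_eq (𝕜 := ℝ)) w
  rw [fderiv_clm_apply (hG.clm_apply hV) hV] at hGVV
  simp only [fderiv_fun_const, Pi.zero_apply, zero_apply, add_apply,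
    ContinuousLinearMap.comp_apply, ContinuousLinearMap.flip_apply, hGV,
    hsymm (fderiv ℝ V y w)] at hGVV
  rw [hGV, hGV, hsymm (fderiv ℝ V y w)]
  linarith

lemma metricInChart_vectorFieldInChart
    (g : Π x : M, TangentSpace 𝓘(ℝ, E) x →L[ℝ] TangentSpace 𝓘(ℝ, E) x →L[ℝ] ℝ)
    (X : Π x : M, TangentSpace 𝓘(ℝ, E) x) [IsManifold 𝓘(ℝ, E) ∞ M] (hy : y ∈ (φ x₀).target) :
    metricInChart g x₀ y (vectorFieldInChart X x₀ y) =
      oneFormInChart (fun x ↦ g x (X x)) x₀ y :=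
  ContinuousLinearMap.ext fun w ↦ congrArg
    (fun u ↦ g ((φ x₀).symm y) u (𝐓 (φ x₀).symm y w)) (mfderiv_symm_vectorFieldInChart X hy)

lemma diffForm_exp {h : M → ℝ} (hh : MDifferentiableAt 𝓘(ℝ, E) 𝓘(ℝ, ℝ) h x) (v : E) :
    diffForm (fun p ↦ Real.exp (h p)) x v = Real.exp (h x) * diffForm h x v := by
  have hexp := (Real.hasDerivAt_exp (h x)).hasFDerivAt.hasMFDerivAt
  refine (DFunLike.congr_fun (hexp.comp x hh.hasMFDerivAt).mfderiv v).trans ?_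
  exact mul_comm (diffForm h x v) (Real.exp (h x))

section Charts

variable [IsManifold 𝓘(ℝ, E) ∞ M] {h : M → ℝ}
  (g : Bundle.ContMDiffRiemannianMetric 𝓘(ℝ, E) ∞ E (fun x : M ↦ TangentSpace 𝓘(ℝ, E) x))

lemma isSmoothOneForm_inner (hX : IsSmoothVectorField X) :
    IsSmoothOneForm fun x ↦ g.inner x (X x) := by
  refine isSmoothOneForm_iff.2 fun x ↦ ?_
  have hx := mem_extChartAt_target (I := 𝓘(ℝ, E)) x
  refine ((contDiffAt_metricInChart g hx).clm_apply (hX.contDiffAt hx)).congr_of_eventuallyEq ?_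
  filter_upwards [eventually_mem_extChartAt_target (mem_extChartAt_source x)] with y hy
  exact (metricInChart_vectorFieldInChart g.inner X hy).symm

lemma loweredAcceleration_eq_extD (hX : IsSmoothVectorField X)
    (hunit : ∀ x, g.inner x (X x) (X x) = 1) (x : M) (w : E) :
    loweredAcceleration g.inner X x w = extD (fun x ↦ g.inner x (X x)) x ![X x, w] := by
  have hx := mem_extChartAt_target (I := 𝓘(ℝ, E)) x
  have hchart : (fun y ↦ metricInChart g.inner x y (vectorFieldInChart X x y))
      =ᶠ[𝓝 (φ x x)] oneFormInChart (fun x ↦ g.inner x (X x)) x := by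
    filter_upwards [eventually_mem_extChartAt_target (mem_extChartAt_source x)] with y hy
    exact metricInChart_vectorFieldInChart g.inner X hy
  refine Eq.trans ?_
    (extD_apply ((isSmoothOneForm_inner g hX).differentiableAt hx) (X x) w).symm
  rw [← vectorFieldInChart_self X x, ← hchart.fderiv_eq]
  refine acceleration_eq_of_apply_self_eq_one
    ((contDiffAt_metricInChart g hx).differentiableAt (by simp)) (hX.differentiableAt hx)
    (fun v w ↦ ?_) ?_ w
  · rw [metricInChart_self, metricInChart_self]
    exact g.symm x v w
  · filter_upwards [eventually_mem_extChartAt_target (mem_extChartAt_source x)] with y hy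
    rw [metricInChart_vectorFieldInChart g.inner X hy, oneFormInChart_vectorFieldInChart _ _ hy,
      hunit]

theorem foliationIsTotallyGeodesic_iff_extD_inner_eq_zero [CompleteSpace E]
    (hX : IsSmoothVectorField X) (hunit : ∀ x, g.inner x (X x) (X x) = 1) :
    FoliationIsTotallyGeodesic g.inner X ↔
      ∀ x (w : E), extD (fun x ↦ g.inner x (X x)) x ![X x, w] = 0 := by
  simp only [foliationIsTotallyGeodesic_iff_loweredAcceleration_eq_zero hX hunit
    (isSmoothOneForm_inner g hX), loweredAcceleration_eq_extD g hX hunit]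

lemma IsSmoothVectorField.smul (hh : ContMDiff 𝓘(ℝ, E) 𝓘(ℝ, ℝ) ∞ h)
    (hX : IsSmoothVectorField X) : IsSmoothVectorField fun x ↦ h x • X x :=
  ContMDiffOn.smul_section hh.contMDiffOn hX

lemma extD_exp_smul_apply (hτ : IsSmoothOneForm τ) (hZ : IsSmoothVectorField Z)
    (hτZ : ∀ x, τ x (Z x) = 1) (hh : ContMDiff 𝓘(ℝ, E) 𝓘(ℝ, ℝ) ∞ h) (x : M) (w : E) :
    extD (fun p ↦ Real.exp (h p) • τ p) x ![Real.exp (-h x) • Z x, w] =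
      lieDerivOneForm Z τ x w - horizontalDiff τ Z h x w := by
  have hhx := hh.mdifferentiableAt (x := x) (by simp)
  have hexp : MDifferentiableAt 𝓘(ℝ, E) 𝓘(ℝ, ℝ) (fun p ↦ Real.exp (h p)) x :=
    (Real.contDiff_exp.contMDiff.comp hh).mdifferentiableAt (by simp)
  have hdexp := extD_smul_apply hexp (hτ.differentiableAt (mem_extChartAt_target x)) (Z x) w
  rw [diffForm_exp hhx (Z x), diffForm_exp hhx w, hτZ] at hdexp
  have hL : lieDerivOneForm Z τ x w = extD τ x ![Z x, w] :=
    lieDerivOneForm_apply_of_apply_eq_one hτ hZ hτZ x w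
  refine ((extD (fun p ↦ Real.exp (h p) • τ p) x).toAlternatingMap.map_vecCons_smul ![w] _
    (Z x)).trans ?_
  refine (congrArg (Real.exp (-h x) • ·) hdexp).trans ?_
  have hmul : Real.exp (-h x) * Real.exp (h x) = 1 := by
    rw [← Real.exp_add, neg_add_cancel, Real.exp_zero]
  have hhor : horizontalDiff τ Z h x w = diffForm h x w + -diffForm h x (Z x) * τ x w := rfl
  rw [hhor, hL, smul_eq_mul]
  linear_combination
    (diffForm h x (Z x) * τ x w - diffForm h x w + extD τ x ![Z x, w]) * hmul

theorem foliationIsTotallyGeodesic_iff_lieDerivOneForm_eq [CompleteSpace E]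
    (hτ : IsSmoothOneForm τ) (hZ : IsSmoothVectorField Z) (hτZ : ∀ x, τ x (Z x) = 1)
    (hh : ContMDiff 𝓘(ℝ, E) 𝓘(ℝ, ℝ) ∞ h)
    (hgZ : ∀ x v, g.inner x (Z x) v = Real.exp (2 * h x) * τ x v) :
    FoliationIsTotallyGeodesic g.inner Z ↔ lieDerivOneForm Z τ = horizontalDiff τ Z h := by
  have hX : IsSmoothVectorField fun x ↦ Real.exp (-h x) • Z x :=
    hZ.smul (Real.contDiff_exp.contMDiff.comp hh.neg)
  have hgX : (fun x ↦ g.inner x (Real.exp (-h x) • Z x)) = fun x ↦ Real.exp (h x) • τ x := by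
    refine funext fun x ↦ ContinuousLinearMap.ext fun v ↦ ?_
    rw [map_smul, smul_apply, hgZ, smul_apply, smul_eq_mul, smul_eq_mul, ← mul_assoc,
      ← Real.exp_add]
    ring_nf
  have hunit (x : M) :
      g.inner x (Real.exp (-h x) • Z x) (Real.exp (-h x) • Z x) = 1 := by
    rw [congrFun hgX x, smul_apply, map_smul, hτZ, smul_eq_mul, smul_eq_mul, mul_one,
      ← Real.exp_add, add_neg_cancel, Real.exp_zero]
  rw [← foliationIsTotallyGeodesic_smul_iff fun x ↦ Real.exp_ne_zero (-h x),
    foliationIsTotallyGeodesic_iff_extD_inner_eq_zero g hX hunit, hgX]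
  simp only [extD_exp_smul_apply hτ hZ hτZ hh, sub_eq_zero]
  exact ⟨fun H ↦ funext fun x ↦ ContinuousLinearMap.ext (H x),
    fun H x w ↦ DFunLike.congr_fun (congrFun H x) w⟩

lemma inner_eq_mul_of_forall_mem_kerForm (hτZ : τ x (Z x) = 1)
    (horth : ∀ v ∈ kerForm τ x, g.inner x v (Z x) = 0) (v : TangentSpace 𝓘(ℝ, E) x) :
    g.inner x (Z x) v = g.inner x (Z x) (Z x) * τ x v := by
  have hv : v - τ x v • Z x ∈ kerForm τ x := by
    change τ x (v - τ x v • Z x) = 0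
    rw [map_sub, map_smul, hτZ, smul_eq_mul, mul_one, sub_self]
  have hv' := horth _ hv
  rw [g.symm, map_sub, map_smul, smul_eq_mul, sub_eq_zero] at hv'
  rw [hv', mul_comm]

lemma forall_inner_eq_zero_iff_exists_inner_eq_exp_mul (hZ : IsSmoothVectorField Z)
    (hτZ : ∀ x, τ x (Z x) = 1) :
    (∀ x, ∀ v ∈ kerForm τ x, ∀ w ∈ Submodule.span ℝ {Z x}, g.inner x v w = 0) ↔
      ∃ h : M → ℝ, ContMDiff 𝓘(ℝ, E) 𝓘(ℝ, ℝ) ∞ h ∧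
        ∀ x v, g.inner x (Z x) v = Real.exp (2 * h x) * τ x v := by
  constructor
  · intro horth
    have hpos (x : M) : 0 < g.inner x (Z x) (Z x) :=
      g.pos x (Z x) fun hZ₀ ↦ by simpa [hZ₀] using hτZ x
    refine ⟨fun x ↦ Real.log (g.inner x (Z x) (Z x)) / 2, fun x ↦ ?_, fun x v ↦ ?_⟩
    · exact ContMDiffAt.comp x (g := fun r ↦ Real.log r / 2)
        ((Real.contDiffAt_log.2 (hpos x).ne').div_const 2).contMDiffAt
        ((isSmoothOneForm_inner g hZ).contMDiff_apply hZ x)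
    · rw [mul_div_cancel₀ _ two_ne_zero, Real.exp_log (hpos x)]
      exact inner_eq_mul_of_forall_mem_kerForm g (hτZ x)
        (fun v hv ↦ horth x v hv _ (Submodule.mem_span_singleton_self _)) v
  · rintro ⟨h, -, hgZ⟩ x v hv w hw
    obtain ⟨r, rfl⟩ := Submodule.mem_span_singleton.1 hw
    have hτv : τ x v = 0 := hv
    rw [map_smul, g.symm, hgZ, hτv, mul_zero, smul_zero]

theorem exists_foliationIsTotallyGeodesic_iff [FiniteDimensional ℝ E] [T2Space M]
    [SigmaCompactSpace M] (hτ : IsSmoothOneForm τ) (hZ : IsSmoothVectorField Z)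
    (hτZ : ∀ x, τ x (Z x) = 1) :
    (∃ g : Bundle.ContMDiffRiemannianMetric 𝓘(ℝ, E) ∞ E (fun x : M ↦ TangentSpace 𝓘(ℝ, E) x),
      FoliationIsTotallyGeodesic g.inner Z ∧
      ∀ x, ∀ v ∈ kerForm τ x, ∀ w ∈ Submodule.span ℝ {Z x}, g.inner x v w = 0) ↔
    ∃ h : M → ℝ, ContMDiff 𝓘(ℝ, E) 𝓘(ℝ, ℝ) ∞ h ∧ lieDerivOneForm Z τ = horizontalDiff τ Z h := by
  have : CompleteSpace E := FiniteDimensional.complete ℝ E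
  constructor
  · rintro ⟨g, hg, horth⟩
    obtain ⟨h, hh, hgZ⟩ := (forall_inner_eq_zero_iff_exists_inner_eq_exp_mul g hZ hτZ).1 horth
    exact ⟨h, hh, (foliationIsTotallyGeodesic_iff_lieDerivOneForm_eq g hτ hZ hτZ hh hgZ).1 hg⟩
  · rintro ⟨h, hh, hL⟩
    have hexp : ContMDiff 𝓘(ℝ, E) 𝓘(ℝ, ℝ) ∞ fun x ↦ Real.exp (2 * h x) :=
      Real.contDiff_exp.contMDiff.comp ((contDiff_const.mul contDiff_id).contMDiff.comp hh)
    obtain ⟨g, hgZ⟩ := exists_riemannianMetric_apply_eq_mul hτ hZ hτZ hexp fun x ↦ Real.exp_pos _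
    exact ⟨g, (foliationIsTotallyGeodesic_iff_lieDerivOneForm_eq g hτ hZ hτZ hh hgZ).2 hL,
      (forall_inner_eq_zero_iff_exists_inner_eq_exp_mul g hZ hτZ).2 ⟨h, hh, hgZ⟩⟩

end Charts

end UnitField

end ZFoliation

end

theorem mainTheorem7
    {E : Type*} [NormedAddCommGroup E] [NormedSpace ℝ E] [FiniteDimensional ℝ E]
    {M : Type*} [TopologicalSpace M] [ChartedSpace E M] [IsManifold 𝓘(ℝ, E) ∞ M]
    [T2Space M] [SecondCountableTopology M] [SimplyConnectedSpace M]
    (τ : Π x : M, TangentSpace 𝓘(ℝ, E) x →L[ℝ] ℝ)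
    (hτ : ZFoliation.IsSmoothOneForm τ)
    (hτ0 : ∀ x, τ x ≠ 0)
    (hdτ : ∀ x, ∃ v ∈ ZFoliation.kerForm τ x, ∃ w ∈ ZFoliation.kerForm τ x,
      ZFoliation.extD τ x ![v, w] ≠ 0)
    (Z : Π x : M, TangentSpace 𝓘(ℝ, E) x)
    (hZ : ZFoliation.IsSmoothVectorField Z)
    (hτZ : ∀ x, τ x (Z x) = 1)
    (χ : Π x : M, ⋀[ℝ]^2 (TangentSpace 𝓘(ℝ, E) x))
    (hχ : ZFoliation.IsSmoothBivectorField (ZFoliation.kerForm τ) χ)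
    (hdτχ : ∀ x, ZFoliation.evalBivector (ZFoliation.extD τ x) (χ x) = -1) :
    (∃ g : Bundle.ContMDiffRiemannianMetric 𝓘(ℝ, E) ∞ E
        (fun x : M ↦ TangentSpace 𝓘(ℝ, E) x),
      ZFoliation.FoliationIsTotallyGeodesic g.inner Z ∧
      ∀ x, ∀ v ∈ ZFoliation.kerForm τ x, ∀ w ∈ Submodule.span ℝ {Z x}, g.inner x v w = 0) ↔
    ∀ x, ZFoliation.dSelector τ χ (ZFoliation.lieDerivOneForm Z τ) x = 0 := by
  have : LocallyCompactSpace M := ChartedSpace.locallyCompactSpace E M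
  rw [ZFoliation.dSelector_lieDerivOneForm_eq_zero_iff hτ hZ hτZ hχ hdτχ]
  exact ZFoliation.exists_foliationIsTotallyGeodesic_iff hτ hZ hτZ
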